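/- All cardinals and ordinals are those of ZFC. Let $\mathsf{GCH}$ be the statement that $2^{c}=c^{+}$ for every infinite cardinal $c$. For infinite cardinals $\lambda\ge\eta\ge\kappa$ with $\eta,\kappa$ regular, $\mathsf{VWS}(\lambda,\eta,\kappa)$ is the statement that there are a sequence $\langle C_\alpha:\alpha<\lambda^+\rangle$ and a club $D\subseteq\lambda^+$ such that for each $\alpha\in D$ with $\mathrm{cf}(\alpha)\ge\eta$: (i) $C_\alpha$ is a cofinal subset of $\alpha\cap D$ of order type $\mathrm{cf}(\alpha)$, and (ii) for each $Y\in[C_\alpha]^{<\kappa}$ there is $\xi<\alpha$ with $Y\subseteq C_\xi\in[C_\alpha]^{<\kappa}$. $\mathsf{VWS}$ is the statement that $\mathsf{VWS}(\lambda,\eta,\kappa)$ holds for all infinite cardinals $\lambda\ge\eta\ge\kappa$ with $\eta,\kappa$ regular. $\square$ is the statement that Jensen's $\square_\lambda$ holds for every uncountable cardinal $\lambda$: there is a sequence $\langle C_\alpha:\alpha<\lambda^+,\ \alpha\text{ limit}\rangle$ such that $C_\alpha$ is a club in $\alpha$ of order type at most $\lambda$, and $C_\beta=C_\alpha\cap\beta$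 for every limit point $\beta<\alpha$ of $C_\alpha$. In a poset $\mathbb P$, $q\le p$ is read "$q$ extends $p$"; elements are compatible if they have a common extension; $\mathbb P$ is separative if whenever $q\not\le p$ some $r\le q$ is incompatible with $p$. The Souslin number $S(\mathbb P)$ is the least cardinal $\kappa$ such that every set of pairwise incompatible elements has size $<\kappa$. A set $\mathbb D\subseteq\mathbb P$ is dense if every element of $\mathbb P$ has an extension in $\mathbb D$; its Noetherian type is the least cardinal $\kappa$ such that $|\{p\in\mathbb D: q\le p\}|<\kappa$ for all $q\in\mathbb P$; and $\pi\mathrm{Nt}(\mathbb P)$ is the least Noetherian type of a dense subset of $\mathbb P$. Let $\bigtriangledown$ be the statement that $\pi\mathrm{Nt}(\mathbb P)\le S(\mathbb P)$ for every separative poset $\mathbb P$. A space is quasi-regular if it is Hausdorff and every nonempty open set contains the closure of a nonempty open set. In the Banach–Mazur game on $X$ the players EMPTY and NONEMPTY alternately choose nonempty open sets $U_0\supseteq V_0\supseteq U_1\supseteq V_1\supseteq\cdots$, EMPTY choosing the $U_n$ and NONEMPTY the $V_n$; NONEMPTY wins iff $\bigcap_n U_n=\bigcap_n V_n\ne\emptyset$.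 A strategy for NONEMPTY assigns to every nested sequence $U_0\supseteq V_0\supseteq\cdots\supseteq V_{n-1}\supseteq U_n$ of nonempty open sets a nonempty open $V_n\subseteq U_n$; it is winning if NONEMPTY wins every play in which she follows it; it is a $2$-tactic if $V_n$ depends only on EMPTY's last two moves $(U_{n-1},U_n)$ (only on $U_0$ when $n=0$). **Theorem.** (1) $\mathsf{GCH}+\mathsf{VWS}$ implies $\bigtriangledown$. (2) Consequently, $\mathsf{GCH}+\mathsf{VWS}$ implies that for every quasi-regular space $X$, if NONEMPTY has a winning strategy in the Banach–Mazur game on $X$, then she has a winning $2$-tactic. (3) In particular, the conclusion of (2) holds under $\mathsf{GCH}+\square$. -/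

import Mathlib

open Cardinal Set

universe u

noncomputable section

/-! ### Set-theoretic hypotheses -/

/-- The generalized continuum hypothesis: `2 ^ c = c⁺` for every infinite cardinal `c`. -/
def GCH : Prop :=
  ∀ c : Cardinal.{u}, ℵ₀ ≤ c → (2 : Cardinal.{u}) ^ c = Order.succ c

/-- The set of ordinals below the cardinal successor of `lam`, i.e. the well-order `lam⁺`. -/
abbrev SuccOrd (lam : Cardinal.{u}) : Type u := (Order.succ lam).ord.ToType

/-- The Very Weak Square principle for `(lam, eta, kap)`: there are a sequence of sets `C a`
(`a < lam⁺`) and a club `D` in `lam⁺` such that for all `a ∈ D` of cofinality at least `eta`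
* `C a` is a cofinal subset of `a ∩ D` of order type `cf a`;
* every subset of `C a` of size less than `kap` is contained in some `C x`, `x < a`, which is
  itself a subset of `C a` of size less than `kap`. -/
def VeryWeakSquareAt (lam eta kap : Cardinal.{u}) : Prop :=
  ∃ (C : SuccOrd lam → Set (SuccOrd lam)) (D : Set (SuccOrd lam)), IsClub D ∧
    ∀ a ∈ D, eta ≤ Order.cof (Iio a) →
      (C a ⊆ Iio a ∩ D ∧
        (∀ b ∈ Iio a ∩ D, ∃ c ∈ C a, b ≤ c) ∧
        Ordinal.type (α := C a) (· < ·) = (Order.cof (Iio a)).ord) ∧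
      ∀ X : Set (SuccOrd lam), X ⊆ C a → #X < kap →
        ∃ x < a, X ⊆ C x ∧ C x ⊆ C a ∧ #(C x) < kap

/-- `VWS`: the Very Weak Square principle for all infinite cardinals `lam ≥ eta ≥ kap` with
`eta` and `kap` regular. -/
def VWS : Prop :=
  ∀ lam eta kap : Cardinal.{u}, kap ≤ eta → eta ≤ lam → eta.IsRegular → kap.IsRegular →
    VeryWeakSquareAt lam eta kap

/-- `b` is a limit point of the set `A` in a linear order without regard to membership in `A`:
`A` has elements below `b`, and they are cofinal in `b`. -/
def IsLimitPointBelow {α : Type u} [LinearOrder α] (A : Set α) (b : α) : Prop :=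
  (∃ a ∈ A, a < b) ∧ ∀ c < b, ∃ a ∈ A, c < a ∧ a < b

/-- Jensen's square principle at `lam`: there is a sequence of clubs `C a ⊆ a`, for limit ordinals
`a < lam⁺`, of order type at most `lam`, which is coherent: `C b = C a ∩ b` for each limit point
`b < a` of `C a`. -/
def SquareAt (lam : Cardinal.{u}) : Prop :=
  ∃ C : SuccOrd lam → Set (SuccOrd lam), ∀ a, Order.IsSuccLimit a →
    C a ⊆ Iio a ∧
    IsClub {x : Iio a | x.1 ∈ C a} ∧
    Ordinal.type (α := C a) (· < ·) ≤ lam.ord ∧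
    ∀ b < a, IsLimitPointBelow (C a) b → C b = C a ∩ Iio b

/-- The square principle: it holds at every uncountable cardinal. -/
def Square : Prop :=
  ∀ lam : Cardinal.{u}, ℵ₀ < lam → SquareAt lam

/-! ### Partially ordered sets

`q ≤ p` means that `q` extends `p`. -/

section Posets

variable (P : Type u) [PartialOrder P]

variable {P} in
/-- Two elements are compatible if they have a common extension. -/
def PosetCompatible (p q : P) : Prop := ∃ r, r ≤ p ∧ r ≤ q

/-- `P` is separative: if `q ≰ p`, then some extension of `q` is incompatible with `p`. -/
def IsSeparative : Prop :=
  ∀ p q : P, ¬ q ≤ p → ∃ r ≤ q, ¬ PosetCompatible r p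

/-- `P` has the `kap`-chain condition: every set of pairwise incompatible elements has size less
than `kap`. -/
def HasCC (kap : Cardinal.{u}) : Prop :=
  ∀ A : Set P, (A.Pairwise fun p q => ¬ PosetCompatible p q) → #A < kap

/-- The Souslin number of `P`: the least `kap` such that `P` has the `kap`-chain condition. -/
def souslinNumber : Cardinal.{u} := sInf {kap | HasCC P kap}

variable {P} in
/-- `D` is dense in `P`: every element of `P` has an extension in `D`. -/
def IsDenseSubset (D : Set P) : Prop := ∀ p : P, ∃ q ∈ D, q ≤ p

variable {P} in
/-- The Noetherian type of `D ⊆ P`: the least `kap` such that every element of `P` extends fewer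
than `kap` elements of `D`. -/
def noetherianType (D : Set P) : Cardinal.{u} :=
  sInf {kap | ∀ q : P, #{p : P | p ∈ D ∧ q ≤ p} < kap}

/-- The `π`-Noetherian type of `P`: the least Noetherian type of a dense subset of `P`. -/
def piNoetherianType : Cardinal.{u} :=
  sInf {kap | ∃ D : Set P, IsDenseSubset D ∧ noetherianType D = kap}

end Posets

/-- The statement `▽`: the `π`-Noetherian type of every separative poset is at most its Souslin
number. -/
def Nabla : Prop :=
  ∀ (P : Type u) [PartialOrder P], IsSeparative P → piNoetherianType P ≤ souslinNumber P

/-! ### The Banach-Mazur game -/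

section Game

variable (X : Type u) [TopologicalSpace X]

/-- Quasi-regular spaces: Hausdorff spaces in which every nonempty open set contains the closure
of a nonempty open set. -/
def IsQuasiRegular : Prop :=
  T2Space X ∧ ∀ U : Set X, IsOpen U → U.Nonempty →
    ∃ V : Set X, IsOpen V ∧ V.Nonempty ∧ closure V ⊆ U

/-- The moves of the game: nonempty open sets, ordered by inclusion. -/
abbrev NonemptyOpen : Type u := {U : Set X // IsOpen U ∧ U.Nonempty}

/-- A position in which NONEMPTY has to move: nonempty open sets
`U 0 ⊇ V 0 ⊇ ⋯ ⊇ U (n - 1) ⊇ V (n - 1) ⊇ U n`. -/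
structure BMPosition where
  /-- the index of the current round -/
  n : ℕ
  /-- the moves of EMPTY -/
  U : Fin (n + 1) → NonemptyOpen X
  /-- the moves of NONEMPTY -/
  V : Fin n → NonemptyOpen X
  V_le : ∀ i : Fin n, V i ≤ U i.castSucc
  U_le : ∀ i : Fin n, U i.succ ≤ V i

/-- A (full information) strategy for NONEMPTY. -/
structure BMStrategy where
  /-- the answer of NONEMPTY -/
  move : BMPosition X → NonemptyOpen X
  move_le : ∀ p, move p ≤ p.U (Fin.last p.n)

/-- A complete play of the game: nonempty open sets `U 0 ⊇ V 0 ⊇ U 1 ⊇ V 1 ⊇ ⋯`. -/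
structure BMPlay where
  /-- the moves of EMPTY -/
  U : ℕ → NonemptyOpen X
  /-- the moves of NONEMPTY -/
  V : ℕ → NonemptyOpen X
  V_le : ∀ n, V n ≤ U n
  U_le : ∀ n, U (n + 1) ≤ V n

variable {X}

/-- The position of a play in round `n`, after EMPTY's move. -/
def BMPlay.position (P : BMPlay X) (n : ℕ) : BMPosition X where
  n := n
  U i := P.U i
  V i := P.V i
  V_le i := P.V_le i
  U_le i := P.U_le i

/-- NONEMPTY plays according to the strategy `σ`. -/
def BMPlay.Follows (P : BMPlay X) (σ : BMStrategy X) : Prop :=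
  ∀ n, P.V n = σ.move (P.position n)

/-- NONEMPTY wins the play: the sets played have a common point. -/
def BMPlay.NonemptyWins (P : BMPlay X) : Prop :=
  (⋂ n, (P.U n : Set X)) = ⋂ n, (P.V n : Set X) ∧ (⋂ n, (P.V n : Set X)).Nonempty

/-- A winning strategy for NONEMPTY. -/
def BMStrategy.IsWinning (σ : BMStrategy X) : Prop :=
  ∀ P : BMPlay X, P.Follows σ → P.NonemptyWins

/-- `σ` is a `k`-tactic: the answer depends only on the list of the last `k` moves of EMPTY (of
all her moves, if there have been fewer than `k`). -/
def BMStrategy.UsesLastMoves (σ : BMStrategy X) (k : ℕ) : Prop :=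
  ∃ ς : List (Set X) → Set X, ∀ p : BMPosition X,
    (σ.move p : Set X) = ς ((List.ofFn fun i => (p.U i : Set X)).rtake k)

end Game

end

/-! ### Well-orders and cofinality -/

/-! The heart is a decomposition theorem, `hasLayering`. Let `κ` be regular and let `A` be closed
under an operation on sets of size `<κ`. Under `GCH` and `VWS`, `A` splits into well-ordered layers
of size at most `κ` such that the part below any layer is a union of fewer than `κ` closed sets. The
proof is by induction on `|A|`. At a limit cardinal, `A` is an increasing union of smaller closures.
At `μ⁺`, very weak square presents suitable initial segments as unions of fewer than `κ` closed sets
(`hasLayering_of_succ`).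

For `▽`, this is applied to the regular sets of a `κ`-cc separative poset, under intersection
(`exists_dense_of_hasCC`). Order them by layer and then by index within the layer, and keep those
nonempty sets that come first among their nonempty regular subsets. By the chain condition, every
element `b` has, in each closed set, a least member above it. Induction on layers then shows that
`b` lies below fewer than `κ` kept sets. A point chosen in each kept set gives the dense set. For
arbitrary posets this is done below a maximal incompatible family of elements with constant local
Souslin number (`exists_dense_lt_localSouslin`), which gives a local form of `▽`.

For the game, apply this to the nonempty regular open sets. Any `w` in the dense set `D` has few
elements of `D` above it, so the finite lists of them can be coded by incompatible sets below `w`.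
NONEMPTY replaces EMPTY's moves by codes of the history, and the last two moves of EMPTY then
determine all that her strategy needs (`exists_winning_two_tactic`). Finally `□` with `GCH` gives
`VWS`: coherence makes the bounded parts of `C a` members of small families fixed in advance. -/

theorem exists_forall_lt_of_mk_lt_cof {I : Type u} [LinearOrder I] {s : Set I}
    (h : #s < Order.cof I) : ∃ x, ∀ y ∈ s, y < x :=
  not_isCofinal_iff.1 fun hs => h.not_ge (Order.cof_le hs)

theorem exists_lt_forall_lt_of_mk_lt_cof_Iio {I : Type u} [LinearOrder I] {a : I} {s : Set I}
    (hs : s ⊆ Iio a) (h : #s < Order.cof (Iio a)) : ∃ b < a, ∀ y ∈ s, y < b := by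
  have h' : #((Subtype.val : Iio a → I) ⁻¹' s) < Order.cof (Iio a) :=
    (mk_preimage_of_injective _ _ Subtype.val_injective).trans_lt h
  obtain ⟨b, hb⟩ := exists_forall_lt_of_mk_lt_cof h'
  exact ⟨b, b.2, fun y hy => hb ⟨y, hs hy⟩ hy⟩

/-- A set of size less than `kap` is covered by a proper initial segment of `kap`. -/
theorem exists_mk_Iio_eq {kap c : Cardinal.{u}} (h : c < kap) :
    ∃ x : kap.ord.ToType, #(Iio x) = c := by
  have h1 : c.ord < Ordinal.type (α := kap.ord.ToType) (· < ·) := by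
    rw [Ordinal.type_toType]; exact ord_lt_ord.2 h
  obtain ⟨x, hx⟩ := Ordinal.typein_surj (α := kap.ord.ToType) (· < ·) h1
  refine ⟨x, ?_⟩
  have := congrArg Ordinal.card hx
  rw [card_ord] at this
  rw [← this]; rfl

theorem mk_Iio_lt_of_ord_toType {kap : Cardinal.{u}} (x : kap.ord.ToType) : #(Iio x) < kap :=
  by simpa using mk_Iio_lt x

theorem mk_Iio_succOrd_le {lam : Cardinal.{u}} (x : SuccOrd lam) : #(Iio x) ≤ lam :=
  Order.lt_succ_iff.1 (mk_Iio_lt_of_ord_toType x)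

theorem mk_Iic_lt_of_ord_toType {kap : Cardinal.{u}} (hk : ℵ₀ ≤ kap) (x : kap.ord.ToType) :
    #(Iic x) < kap := by
  rw [← Iio_union_right]
  refine (mk_union_le _ _).trans_lt (add_lt_of_lt hk (mk_Iio_lt_of_ord_toType x) ?_)
  rw [mk_singleton]
  exact one_lt_aleph0.trans_le hk

theorem cof_succOrd {lam : Cardinal.{u}} (hl : ℵ₀ ≤ lam) :
    Order.cof (SuccOrd lam) = Order.succ lam := by
  rw [Ordinal.cof_toType]; exact (isRegular_succ hl).cof_ord

/-- Above every point there is one of cofinality at least `kap` that is closed under `h`. -/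
theorem exists_closed_le_cof {I : Type u} [LinearOrder I] [WellFoundedLT I] {kap : Cardinal.{u}}
    (hk : kap.IsRegular) (hkI : kap < Order.cof I) (hI : ∀ z : I, #(Iic z) < Order.cof I)
    (h : I → I) (x : I) :
    ∃ a, x < a ∧ (∀ y < a, h y < a) ∧ kap ≤ Order.cof (Iio a) := by
  have hH : ∀ z, ∃ w, ∀ y ∈ Iic z ∪ h '' Iic z, y < w := fun z =>
    exists_forall_lt_of_mk_lt_cof <| (mk_union_le _ _).trans_lt <|
      add_lt_of_lt (hk.aleph0_le.trans hkI.le) (hI z) (mk_image_le.trans_lt (hI z))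
  choose H hH using hH
  let K := kap.ord.ToType
  classical
  -- A sequence of length `κ` that jumps past `H` at each step; its supremum is closed under `h`,
  -- and regularity of `κ` gives its cofinality. The default `x` is never used, by `hs`.
  let F : (i : K) → ((j : K) → j < i → I) → I := fun i g =>
    if hw : ∃ w, x < w ∧ ∀ j hj, H (g j hj) < w then hw.choose else x
  let s : K → I := WellFounded.fix (wellFounded_lt : WellFounded ((· < ·) : K → K → Prop)) F
  have hs : ∀ i, x < s i ∧ ∀ j < i, H (s j) < s i := by
    intro i
    have hw : ∃ w, x < w ∧ ∀ j (_ : j < i), H (s j) < w := by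
      have hc : #(insert x ((fun j => H (s j)) '' Iio i) : Set I) < Order.cof I := by
        refine (mk_insert_le).trans_lt (add_lt_of_lt (hk.aleph0_le.trans hkI.le) ?_ ?_)
        · exact mk_image_le.trans_lt ((mk_Iio_lt_of_ord_toType i).trans hkI)
        · exact one_lt_aleph0.trans_le (hk.aleph0_le.trans hkI.le)
      obtain ⟨w, hw⟩ := exists_forall_lt_of_mk_lt_cof hc
      exact ⟨w, hw x (mem_insert _ _), fun j hj => hw _ (mem_insert_of_mem _ ⟨j, hj, rfl⟩)⟩
    have e : s i = hw.choose := by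
      change WellFounded.fix _ F i = _
      rw [WellFounded.fix_eq]
      exact dif_pos hw
    rw [e]
    exact hw.choose_spec
  have hne : (∃ a, ∀ i, s i < a) := by
    have hc : #(range s) < Order.cof I := by
      refine mk_range_le.trans_lt ?_
      rwa [mk_toType, card_ord]
    obtain ⟨w, hw⟩ := exists_forall_lt_of_mk_lt_cof hc
    exact ⟨w, fun i => hw _ (mem_range_self i)⟩
  have wf : WellFounded ((· < ·) : I → I → Prop) := wellFounded_lt
  set a := wf.min {a | ∀ i, s i < a} hne with ha
  have hsa : ∀ i, s i < a := wf.min_mem {a | ∀ i, s i < a} hne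
  have hlt : ∀ y < a, ∃ i, y ≤ s i := by
    intro y hy
    by_contra! hc
    exact wf.not_lt_min {a | ∀ i, s i < a} hc hy
  have hsucc : ∀ i : K, ∃ j, i < j := by
    have : NoMaxOrder K := Cardinal.noMaxOrder hk.aleph0_le
    exact fun i => exists_gt i
  have hKne : Nonempty K := by
    rw [← mk_ne_zero_iff, mk_toType, card_ord]; exact hk.ne_zero
  refine ⟨a, (hs hKne.some).1.trans (hsa _), ?_, ?_⟩
  · intro y hy
    obtain ⟨i, hi⟩ := hlt y hy
    obtain ⟨j, hj⟩ := hsucc i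
    exact ((hH (s i) (h y) (Or.inr ⟨y, hi, rfl⟩)).trans ((hs j).2 i hj)).trans (hsa j)
  · refine Order.le_cof_iff.2 fun t ht => ?_
    by_contra! hc
    choose i hi using fun y : t => hlt y.1 y.1.2
    have : #(range i) < Order.cof K := by
      rw [Ordinal.cof_toType, hk.cof_ord]
      exact mk_range_le.trans_lt hc
    obtain ⟨j, hj⟩ := exists_forall_lt_of_mk_lt_cof this
    obtain ⟨y, hy, hjy⟩ := ht ⟨s j, hsa j⟩
    have h1 := hi ⟨y, hy⟩
    have h2 := hj _ (mem_range_self ⟨y, hy⟩)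
    have h3 := (hs j).2 _ h2
    have h4 := hH (s (i ⟨y, hy⟩)) (s (i ⟨y, hy⟩)) (Or.inl le_rfl)
    have h5 : s j ≤ y := hjy
    exact absurd (h5.trans h1) (h4.trans h3).not_ge

/-! ### Cardinal arithmetic under `GCH` -/

theorem GCH.two_power_le (hG : GCH.{u}) {c d : Cardinal.{u}} (hd : ℵ₀ < d) (hc : c < d) :
    2 ^ c ≤ d := by
  have h1 : max c ℵ₀ < d := max_lt hc hd
  calc 2 ^ c ≤ 2 ^ max c ℵ₀ := power_le_power_left two_ne_zero (le_max_left _ _)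
    _ = Order.succ (max c ℵ₀) := hG _ (le_max_right _ _)
    _ ≤ d := Order.succ_le_of_lt h1

/-- A function from fewer than `cf λ` points into `λ` is bounded, so there are at most `λ` bounds to
consider, each contributing at most `2 ^ ν ≤ λ` functions for some `ν < λ`. -/
theorem GCH.power_le_of_lt_cof (hG : GCH.{u}) {lam c : Cardinal.{u}} (hl : ℵ₀ ≤ lam)
    (hc : c < lam.ord.cof) : lam ^ c ≤ lam := by
  rcases lt_or_ge c ℵ₀ with hfin | hinf
  · obtain ⟨n, rfl⟩ := lt_aleph0.1 hfin
    exact power_nat_le hl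
  have hcl : c < lam := hc.trans_le (Ordinal.cof_ord_le _)
  induction c using Cardinal.inductionOn with | _ C =>
  let L := lam.ord.ToType
  have hL : #L = lam := by rw [mk_toType, card_ord]
  have hcof : #C < Order.cof L := by rwa [Ordinal.cof_toType]
  have hcover : (univ : Set (C → L)) ⊆ ⋃ x : L, range fun (g : C → Iio x) (t : C) => (g t).1 := by
    intro g _
    obtain ⟨x, hx⟩ := exists_forall_lt_of_mk_lt_cof (mk_range_le.trans_lt hcof : #(range g) < _)
    exact mem_iUnion.2 ⟨x, fun t => ⟨g t, hx _ (mem_range_self t)⟩, rfl⟩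
  have h1 : #(C → L) ≤ lam * lam := by
    rw [← mk_univ]
    refine (mk_le_mk_of_subset hcover).trans ((mk_iUnion_le _).trans ?_)
    refine mul_le_mul' hL.le (ciSup_le' fun x => mk_range_le.trans ?_)
    rw [← power_def]
    have hx : #(Iio x) < lam := mk_Iio_lt_of_ord_toType x
    calc #(Iio x) ^ #C ≤ (2 ^ max #(Iio x) #C) ^ max #(Iio x) #C :=
          (power_le_power_right ((cantor _).le.trans
            (power_le_power_left two_ne_zero (le_max_left _ _)))).trans
            (power_le_power_left (power_ne_zero _ two_ne_zero) (le_max_right _ _))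
      _ = 2 ^ max #(Iio x) #C := by
          rw [← power_mul, mul_eq_self (hinf.trans (le_max_right _ _))]
      _ ≤ lam := hG.two_power_le (hinf.trans_lt hcl) (max_lt hx hcl)
  rw [← power_def, hL, mul_eq_self hl] at h1
  exact h1

theorem two_power_power_le {m c : Cardinal.{u}} (hm : ℵ₀ ≤ m) (hc : c ≤ m) :
    (2 ^ m : Cardinal.{u}) ^ c ≤ 2 ^ m := by
  rw [← power_mul]
  exact power_le_power_left two_ne_zero (mul_le_of_le hm le_rfl hc)

/-- The number of subsets of size less than `kap`. -/
theorem mk_small_subsets_le {B : Type u} {kap th : Cardinal.{u}} (hk : ℵ₀ ≤ kap) (hkt : kap ≤ th)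
    (hth : ∀ c < kap, th ^ c ≤ th) {Z : Set B} (hZ : #Z ≤ th) :
    #{Y : Set B | Y ⊆ Z ∧ #Y < kap} ≤ th := by
  let K := kap.ord.ToType
  have hcover : {Y : Set B | Y ⊆ Z ∧ #Y < kap} ⊆
      ⋃ x : K, range fun g : Iio x → Z => (range fun t => (g t).1) := by
    rintro Y ⟨hYZ, hY⟩
    obtain ⟨x, hx⟩ := exists_mk_Iio_eq hY
    obtain ⟨e⟩ := Cardinal.eq.1 hx
    refine mem_iUnion.2 ⟨x, fun t => ⟨(e t).1, hYZ (e t).2⟩, ?_⟩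
    ext y
    constructor
    · rintro ⟨t, rfl⟩
      exact (e t).2
    · exact fun hy => ⟨e.symm ⟨y, hy⟩, by simp⟩
  refine (mk_le_mk_of_subset hcover).trans ((mk_iUnion_le _).trans ?_)
  refine mul_le_of_le (hk.trans hkt) ?_ (ciSup_le' fun x => mk_range_le.trans ?_)
  · rwa [mk_toType, card_ord]
  · rw [← power_def]
    exact (power_le_power_right hZ).trans (hth _ (mk_Iio_lt_of_ord_toType x))

theorem exists_gt_of_aleph0_le_cof {I : Type u} [LinearOrder I] (h : ℵ₀ ≤ Order.cof I) (x : I) :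
    ∃ y, x < y := by
  have : #({x} : Set I) < Order.cof I := by
    rw [mk_singleton]
    exact one_lt_aleph0.trans_le h
  obtain ⟨y, hy⟩ := exists_forall_lt_of_mk_lt_cof this
  exact ⟨y, hy x rfl⟩

/-- A nonempty set without greatest element has a least upper bound of the same cofinality. -/
theorem exists_lub_le_cof {I : Type u} [LinearOrder I] [WellFoundedLT I] {kap : Cardinal.{u}}
    (hk : ℵ₀ ≤ kap) {W : Set I} (hW : kap ≤ Order.cof W) (hb : BddAbove W) :
    ∃ d, (∀ w ∈ W, w < d) ∧ (∀ y < d, ∃ w ∈ W, y < w) ∧ kap ≤ Order.cof (Iio d) := by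
  have wf : WellFounded ((· < ·) : I → I → Prop) := wellFounded_lt
  set d := wf.min (upperBounds W) hb with hd
  have hgt : ∀ w ∈ W, ∃ w' ∈ W, w < w' := fun w hw => by
    obtain ⟨w', hw'⟩ := exists_gt_of_aleph0_le_cof (hk.trans hW) ⟨w, hw⟩
    exact ⟨w', w'.2, hw'⟩
  have h1 : ∀ w ∈ W, w < d := fun w hw => by
    obtain ⟨w', hw', h⟩ := hgt w hw
    exact h.trans_le (wf.min_mem _ hb hw')
  have h2 : ∀ y < d, ∃ w ∈ W, y < w := by
    intro y hy
    by_contra! hc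
    exact wf.not_lt_min (upperBounds W) hc hy
  refine ⟨d, h1, h2, Order.le_cof_iff.2 fun t ht => ?_⟩
  by_contra! hc
  choose w hw hlt using fun y : t => h2 y.1 y.1.2
  obtain ⟨⟨v, hv⟩, hv'⟩ := exists_forall_lt_of_mk_lt_cof
    ((mk_range_le.trans_lt hc).trans_le hW : #(range fun y => (⟨w y, hw y⟩ : W)) < _)
  obtain ⟨y, hy, hvy⟩ := ht ⟨v, h1 v hv⟩
  have h3 : v ≤ y := hvy
  have h4 : w ⟨y, hy⟩ < v := hv' _ (mem_range_self ⟨y, hy⟩)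
  exact absurd (h3.trans_lt (hlt ⟨y, hy⟩)) h4.le.not_gt

/-! ### Sets closed under an operation of small arity -/

section Closed

variable {B : Type u} (f : Set B → B) (kap : Cardinal.{u})

/-- `A` is closed under the operation `f`, applied to subsets of size less than `kap`. -/
def IsClosedUnder (A : Set B) : Prop := ∀ Y ⊆ A, #Y < kap → f Y ∈ A

/-- `X` is the union of fewer than `kap` closed sets. -/
def IsSmallUnion (X : Set B) : Prop :=
  ∃ N : Set (Set B), #N < kap ∧ (∀ A ∈ N, IsClosedUnder f kap A) ∧ ⋃₀ N = X

/-- `A` is divided into well-ordered layers of size at most `kap`, such that the union of the layers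
before any given one is the union of fewer than `kap` closed sets. -/
def HasLayering (A : Set B) : Prop :=
  ∃ (L : Type u) (_ : LinearOrder L) (_ : WellFoundedLT L) (r : B → L),
    (∀ l, IsSmallUnion f kap {x | x ∈ A ∧ r x < l}) ∧ ∀ l, #{x | x ∈ A ∧ r x = l} ≤ kap

/-- The closure of `Y` under `f`. -/
def opClosure (Y : Set B) : Set B := ⋂₀ {A | Y ⊆ A ∧ IsClosedUnder f kap A}

variable {f kap}

theorem isClosedUnder_opClosure (Y : Set B) : IsClosedUnder f kap (opClosure f kap Y) :=
  fun Z hZ hc A hA => hA.2 Z (fun _ hz => hZ hz A hA) hc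

theorem subset_opClosure (Y : Set B) : Y ⊆ opClosure f kap Y :=
  fun _ hy _ hA => hA.1 hy

theorem opClosure_subset {Y A : Set B} (hY : Y ⊆ A) (hA : IsClosedUnder f kap A) :
    opClosure f kap Y ⊆ A :=
  fun _ hx => hx A ⟨hY, hA⟩

theorem opClosure_mono {Y Z : Set B} (h : Y ⊆ Z) : opClosure f kap Y ⊆ opClosure f kap Z :=
  opClosure_subset (h.trans (subset_opClosure Z)) (isClosedUnder_opClosure Z)

/-- Each element of the closure is the value of a well-founded tree with leaves in `Y` and nodes
branching over initial segments of `κ`. The hypothesis on `th` bounds the number of such trees. -/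
theorem mk_opClosure_le {th : Cardinal.{u}} (hk : ℵ₀ ≤ kap) (hkt : kap ≤ th)
    (hth : ∀ c < kap, th ^ c ≤ th) {Y : Set B} (hY : #Y ≤ th) : #(opClosure f kap Y) ≤ th := by
  let K := kap.ord.ToType
  let β : Y ⊕ K → Type u := Sum.elim (fun _ => PEmpty) (fun x => Iio x)
  let ev : (Σ a, β a → B) → B := fun p =>
    match p with
    | ⟨Sum.inl y, _⟩ => y.1
    | ⟨Sum.inr _, g⟩ => f (range g)
  let val : WType β → B := WType.elim B ev
  have hW : #(WType β) ≤ th := by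
    refine WType.cardinalMk_le_of_le ((sum_le_mk_mul_iSup _).trans ?_)
    refine mul_le_of_le (hk.trans hkt) ?_ (ciSup_le' ?_)
    · rw [mk_sum, lift_id, lift_id]
      refine add_le_of_le (hk.trans hkt) hY ?_
      rwa [mk_toType, card_ord]
    · rintro (y | x)
      · change th ^ #PEmpty ≤ th
        rw [mk_pempty, power_zero]
        exact one_le_aleph0.trans (hk.trans hkt)
      · exact hth _ (mk_Iio_lt_of_ord_toType x)
  have hcl : opClosure f kap Y ⊆ range val := by
    refine opClosure_subset (fun y hy => ?_) fun Z hZ hc => ?_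
    · exact ⟨WType.mk (Sum.inl ⟨y, hy⟩) PEmpty.elim, rfl⟩
    · obtain ⟨x, hx⟩ := exists_mk_Iio_eq hc
      obtain ⟨e⟩ := Cardinal.eq.1 hx
      choose t ht using hZ
      refine ⟨WType.mk (Sum.inr x) fun i => t (e i).2, ?_⟩
      change f (range fun i : Iio x => val (t (e i).2)) = f Z
      congr 1
      ext z
      constructor
      · rintro ⟨i, rfl⟩
        simp only [ht]
        exact (e i).2
      · exact fun hz => ⟨e.symm ⟨z, hz⟩, by simp [ht]⟩
  exact (mk_le_mk_of_subset hcl).trans (mk_range_le.trans hW)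

theorem mk_opClosure_le_two_power {m : Cardinal.{u}} (hk : ℵ₀ ≤ kap) (hkm : kap ≤ m) {Y : Set B}
    (hY : #Y ≤ m) : #(opClosure f kap Y) ≤ 2 ^ m :=
  mk_opClosure_le hk (hkm.trans (cantor m).le)
    (fun _ hc => two_power_power_le (hk.trans hkm) (hc.le.trans hkm)) (hY.trans (cantor m).le)

theorem IsClosedUnder.isSmallUnion (hk : ℵ₀ ≤ kap) {A : Set B} (hA : IsClosedUnder f kap A) :
    IsSmallUnion f kap A :=
  ⟨{A}, by rw [mk_singleton]; exact one_lt_aleph0.trans_le hk, by simpa using hA, by simp⟩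

theorem isSmallUnion_empty (hk : ℵ₀ ≤ kap) : IsSmallUnion f kap ∅ :=
  ⟨∅, by rw [mk_eq_zero]; exact aleph0_pos.trans_le hk, by simp, by simp⟩

theorem IsSmallUnion.iUnion (hk : kap.IsRegular) {ι : Type u} (hι : #ι < kap) {X : ι → Set B}
    (hX : ∀ i, IsSmallUnion f kap (X i)) : IsSmallUnion f kap (⋃ i, X i) := by
  choose N hN hcl hU using hX
  refine ⟨⋃ i, N i, (card_iUnion_lt_iff_forall_of_isRegular hk hι).2 hN, ?_, ?_⟩
  · intro A hA
    obtain ⟨i, hi⟩ := mem_iUnion.1 hA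
    exact hcl i A hi
  · rw [sUnion_iUnion]
    exact iUnion_congr hU

theorem IsSmallUnion.union (hk : kap.IsRegular) {X Y : Set B} (hX : IsSmallUnion f kap X)
    (hY : IsSmallUnion f kap Y) : IsSmallUnion f kap (X ∪ Y) := by
  obtain ⟨M, hM, hM1, rfl⟩ := hX
  obtain ⟨N, hN, hN1, rfl⟩ := hY
  refine ⟨M ∪ N, (mk_union_le _ _).trans_lt (add_lt_of_lt hk.aleph0_le hM hN), ?_,
    sUnion_union M N⟩
  rintro A (hA | hA)
  exacts [hM1 A hA, hN1 A hA]

theorem isSmallUnion_iUnion_of_cof_lt (hk : kap.IsRegular) {I : Type u} [LinearOrder I]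
    (hI : Order.cof I < kap) {X : I → Set B} (hmono : Monotone X)
    (hX : ∀ i, IsSmallUnion f kap (X i)) : IsSmallUnion f kap (⋃ i, X i) := by
  obtain ⟨s, hs, hsc⟩ := Order.exists_cof_eq I
  have : (⋃ i, X i) = ⋃ i : s, X i.1 := by
    refine Subset.antisymm (iUnion_subset fun i => ?_) (iUnion_subset fun i => subset_iUnion X i.1)
    obtain ⟨j, hj, hij⟩ := hs i
    exact (hmono hij).trans (subset_iUnion (fun i : s => X i.1) ⟨j, hj⟩)
  rw [this]
  exact IsSmallUnion.iUnion hk (hsc.trans_lt hI) fun i => hX i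

/-- The union of an increasing family of closed sets is a small union of closed sets. -/
theorem isSmallUnion_iUnion_of_monotone (hk : kap.IsRegular) {I : Type u} [LinearOrder I]
    {X : I → Set B} (hmono : Monotone X) (hX : ∀ i, IsClosedUnder f kap (X i)) :
    IsSmallUnion f kap (⋃ i, X i) := by
  rcases lt_or_ge (Order.cof I) kap with hlt | hge
  · exact isSmallUnion_iUnion_of_cof_lt hk hlt hmono fun i => (hX i).isSmallUnion hk.aleph0_le
  · refine IsClosedUnder.isSmallUnion hk.aleph0_le fun Y hY hc => ?_
    choose i hi using fun y : Y => mem_iUnion.1 (hY y.2)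
    obtain ⟨x, hx⟩ := exists_forall_lt_of_mk_lt_cof ((mk_range_le.trans_lt hc).trans_le hge :
      #(range i) < _)
    refine mem_iUnion.2 ⟨x, hX x Y (fun y hy => ?_) hc⟩
    exact hmono (hx _ (mem_range_self ⟨y, hy⟩)).le (hi ⟨y, hy⟩)

/-! ### Gluing layerings along a well-order. -/

theorem wellFoundedLT_sigmaLex {I : Type u} {L : I → Type u} [LinearOrder I] [WellFoundedLT I]
    [∀ i, LinearOrder (L i)] [∀ i, WellFoundedLT (L i)] : WellFoundedLT (Σₗ i, L i) := by
  refine ⟨⟨fun ⟨i, l⟩ => ?_⟩⟩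
  induction i using WellFoundedLT.induction with | ind i ihi =>
  induction l using WellFoundedLT.induction with | ind l ihl =>
  refine ⟨_, ?_⟩
  rintro ⟨j, m⟩ h
  rcases Sigma.Lex.lt_def.1 h with h' | ⟨h', h''⟩
  · exact ihi j h' m
  · obtain rfl : j = i := h'
    exact ihl m h''

/-- Layerings of the members of a well-ordered family can be put together. -/
theorem HasLayering.iUnion (hk : kap.IsRegular) {I : Type u} [LinearOrder I] [WellFoundedLT I]
    {A : I → Set B} (hA : ∀ i, HasLayering f kap (A i))
    (hlt : ∀ i, IsSmallUnion f kap (⋃ j : Iio i, A j.1)) : HasLayering f kap (⋃ i, A i) := by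
  rcases (⋃ i, A i).eq_empty_or_nonempty with h0 | hne
  · rw [h0]
    refine ⟨PUnit, inferInstance, inferInstance, fun _ => ⟨⟩, fun l => ?_, fun l => ?_⟩
    · simpa using isSmallUnion_empty hk.aleph0_le
    · simp
  obtain ⟨i0, hi0⟩ := nonempty_iUnion.1 hne
  choose L hL hW r hr hf using hA
  have := @wellFoundedLT_sigmaLex I L _ _ _ _
  have wf : WellFounded ((· < ·) : I → I → Prop) := wellFounded_lt
  classical
  -- Each point is ranked in the first member containing it; the new layers form the lexicographic
  -- sum. The default `i0` only concerns points outside the union.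
  let α : B → I := fun x => if h : ∃ i, x ∈ A i then wf.min {i | x ∈ A i} h else i0
  have hα : ∀ x, (∃ i, x ∈ A i) → x ∈ A (α x) := by
    intro x h
    simp only [α, dif_pos h]
    exact wf.min_mem {i | x ∈ A i} h
  have hα' : ∀ x i, x ∈ A i → α x ≤ i := by
    intro x i h
    have h' : ∃ i, x ∈ A i := ⟨i, h⟩
    simp only [α, dif_pos h']
    exact not_lt.1 (wf.not_lt_min {i | x ∈ A i} h)
  refine ⟨Σₗ i, L i, inferInstance, this, fun x => toLex ⟨α x, r (α x) x⟩, ?_, ?_⟩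
  · rintro ⟨i, l⟩
    have e : {x | x ∈ (⋃ i, A i) ∧ (toLex ⟨α x, r (α x) x⟩ : Σₗ i, L i) < ⟨i, l⟩} =
        (⋃ j : Iio i, A j.1) ∪ {x | x ∈ A i ∧ r i x < l} := by
      ext x
      constructor
      · rintro ⟨hx, h⟩
        have hx' := hα x (mem_iUnion.1 hx)
        rcases Sigma.Lex.lt_def.1 h with h' | ⟨h', h''⟩
        · exact Or.inl (mem_iUnion.2 ⟨⟨α x, h'⟩, hx'⟩)
        · have h3 : α x = i := h'
          subst h3
          exact Or.inr ⟨hx', h''⟩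
      · rintro (hx | ⟨hx, hl⟩)
        · obtain ⟨⟨j, hj⟩, hxj⟩ := mem_iUnion.1 hx
          refine ⟨mem_iUnion.2 ⟨j, hxj⟩, Sigma.Lex.lt_def.2 (Or.inl ?_)⟩
          exact (hα' x j hxj).trans_lt hj
        · refine ⟨mem_iUnion.2 ⟨i, hx⟩, Sigma.Lex.lt_def.2 ?_⟩
          rcases (hα' x i hx).lt_or_eq with h | h
          · exact Or.inl h
          · subst h
            exact Or.inr ⟨rfl, hl⟩
    rw [e]
    exact (hlt i).union hk (hr i l)
  · rintro ⟨i, l⟩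
    refine (mk_le_mk_of_subset ?_).trans (hf i l)
    rintro x ⟨hx, h⟩
    have hx' := hα x (mem_iUnion.1 hx)
    have h1 : (⟨α x, r (α x) x⟩ : Σ i, L i) = ⟨i, l⟩ := h
    obtain ⟨h2, h3⟩ := Sigma.mk.inj_iff.1 h1
    subst h2
    exact ⟨hx', eq_of_heq h3⟩

theorem hasLayering_of_mk_le (hk : kap.IsRegular) {A : Set B} (hA : #A ≤ kap) :
    HasLayering f kap A := by
  refine ⟨PUnit, inferInstance, inferInstance, fun _ => ⟨⟩, fun l => ?_, fun l => ?_⟩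
  · simpa using isSmallUnion_empty hk.aleph0_le
  · simpa using hA

/-- A union of fewer than `kap` closed sets with layerings has one. -/
theorem HasLayering.sUnion (hk : kap.IsRegular) {N : Set (Set B)} (hN : #N < kap)
    (hcl : ∀ A ∈ N, IsClosedUnder f kap A) (hlay : ∀ A ∈ N, HasLayering f kap A) :
    HasLayering f kap (⋃₀ N) := by
  let I := (#N).ord.ToType
  have hI : #I = #N := by rw [mk_toType, card_ord]
  obtain ⟨e⟩ := Cardinal.eq.1 hI
  have : ⋃₀ N = ⋃ i : I, (e i).1 := by
    rw [sUnion_eq_iUnion, e.surjective.iUnion_comp (fun s : N => s.1)]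
  rw [this]
  refine HasLayering.iUnion hk (fun i => hlay _ (e i).2) fun i => ?_
  refine IsSmallUnion.iUnion hk ((mk_set_le (Iio i)).trans_lt (hI.trans_lt hN)) fun j => ?_
  exact (hcl _ (e j.1).2).isSmallUnion hk.aleph0_le

end Closed

/-! ### Every closed set has a layering -/

section Layering

variable {B : Type u} {f : Set B → B} {kap : Cardinal.{u}}

/-- Closures of proper initial segments of an enumeration of `A` are smaller than `A`, because `2 ^
m = m⁺` stays below the limit cardinal `#A`. -/
theorem hasLayering_of_isSuccPrelimit (hG : GCH.{u}) (hk : kap.IsRegular) {A : Set B}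
    (hA : IsClosedUnder f kap A) (hkA : kap < #A) (hlim : ∀ c < #A, Order.succ c < #A)
    (ih : ∀ A' : Set B, #A' < #A → IsClosedUnder f kap A' → HasLayering f kap A') :
    HasLayering f kap A := by
  let I := (#A).ord.ToType
  have hI : #I = #A := by rw [mk_toType, card_ord]
  obtain ⟨e⟩ := Cardinal.eq.1 hI
  have hA0 : ℵ₀ ≤ #A := hk.aleph0_le.trans hkA.le
  let X : I → Set B := fun i => opClosure f kap ((fun j => (e j).1) '' Iio i)
  have hmono : Monotone X := fun i j hij =>
    opClosure_mono (image_mono (Iio_subset_Iio hij))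
  have hXA : ∀ i, X i ⊆ A := fun i => opClosure_subset (by rintro _ ⟨j, -, rfl⟩; exact (e j).2) hA
  have hXc : ∀ i, #(X i) < #A := by
    intro i
    have h1 : #(X i) ≤ 2 ^ max #(Iio i) kap :=
      mk_opClosure_le_two_power hk.aleph0_le (le_max_right _ _)
        (mk_image_le.trans (le_max_left _ _))
    rw [hG _ (hk.aleph0_le.trans (le_max_right _ _))] at h1
    exact h1.trans_lt (hlim _ (max_lt (mk_Iio_lt_of_ord_toType i) hkA))
  have hAX : A = ⋃ i, X i := by
    refine Subset.antisymm (fun x hx => ?_) (iUnion_subset hXA)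
    have : NoMaxOrder I := Cardinal.noMaxOrder hA0
    obtain ⟨i, hi⟩ := exists_gt (e.symm ⟨x, hx⟩)
    exact mem_iUnion.2 ⟨i, subset_opClosure _ ⟨e.symm ⟨x, hx⟩, hi, by simp⟩⟩
  rw [hAX]
  refine HasLayering.iUnion hk (fun i => ih _ (hXc i) (isClosedUnder_opClosure _)) fun i => ?_
  exact isSmallUnion_iUnion_of_monotone (I := Iio i) hk (fun a b hab => hmono hab)
    fun j => isClosedUnder_opClosure _

/-- `mu` is the union of fewer than `kap` sets with small closures. -/
theorem exists_cover_mk_opClosure_le (hG : GCH.{u}) (hk : kap.IsRegular) {mu : Cardinal.{u}}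
    (hmu : kap ≤ mu) (f : Set B → B) :
    ∃ (J : Type u) (T : J → Set mu.ord.ToType), #J < kap ∧ (∀ x, ∃ j, x ∈ T j) ∧
      ∀ j (Y : Set B), #Y ≤ max kap #(T j) → #(opClosure f kap Y) ≤ mu := by
  have hmu0 : ℵ₀ ≤ mu := hk.aleph0_le.trans hmu
  -- If `κ ≤ cf μ`, then `μ ^ c ≤ μ` for `c < κ`, and one piece suffices. Otherwise `μ` is cut into
  -- `cf μ < κ` bounded pieces, and closures of sets of such sizes have size at most `μ` since `μ`
  -- is a strong limit or a bound for the powers below it.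
  rcases le_or_gt kap mu.ord.cof with hcof | hcof
  · refine ⟨PUnit, fun _ => univ, ?_, fun x => ⟨⟨⟩, mem_univ x⟩, fun j Y hY => ?_⟩
    · rw [mk_punit]
      exact one_lt_aleph0.trans_le hk.aleph0_le
    · refine mk_opClosure_le hk.aleph0_le hmu
        (fun c hc => hG.power_le_of_lt_cof hmu0 (hc.trans_le hcof)) (hY.trans (max_le hmu ?_))
      rw [mk_univ, mk_toType, card_ord]
  · have hlt : kap < mu := hmu.lt_of_ne fun h => by
      subst h
      exact hcof.ne hk.cof_ord
    obtain ⟨s, hs, hsc⟩ := Order.exists_cof_eq mu.ord.ToType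
    refine ⟨s, fun j => Iic j.1, ?_, fun x => ?_, fun j Y hY => ?_⟩
    · rwa [hsc, Ordinal.cof_toType]
    · obtain ⟨j, hj, hxj⟩ := hs x
      exact ⟨⟨j, hj⟩, hxj⟩
    · exact (mk_opClosure_le_two_power hk.aleph0_le (le_max_left _ _) hY).trans
        (hG.two_power_le (hk.aleph0_le.trans_lt hlt)
          (max_lt hlt (mk_Iic_lt_of_ord_toType hmu0 _)))

/-- Enumerate `A` in type `μ⁺`. At closure points `x` of cofinality at least `κ`, the small subsets
of `C x` generate fewer than `κ` closed sets with union the initial segment at `x`; such segments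
are then glued, with layerings of the smaller closed sets from the induction hypothesis. -/
theorem hasLayering_of_succ (hG : GCH.{u}) (hk : kap.IsRegular) {mu : Cardinal.{u}}
    (hmu : kap ≤ mu) (hV : VeryWeakSquareAt mu kap kap) {A : Set B}
    (hA : IsClosedUnder f kap A) (hAmu : #A = Order.succ mu)
    (ih : ∀ A' : Set B, #A' ≤ mu → IsClosedUnder f kap A' → HasLayering f kap A') :
    HasLayering f kap A := by
  have hmu0 : ℵ₀ ≤ mu := hk.aleph0_le.trans hmu
  let I := SuccOrd mu
  have hI : #I = #A := by rw [mk_toType, card_ord, hAmu]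
  have hcofI : Order.cof I = Order.succ mu := cof_succOrd hmu0
  obtain ⟨e⟩ := Cardinal.eq.1 hI
  let a : I → B := fun i => (e i).1
  have ha : Function.Injective a := Subtype.val_injective.comp e.injective
  have haA : range a = A := by
    simp only [a, range_comp' Subtype.val e, e.range_eq_univ, image_univ, Subtype.range_coe]
  obtain ⟨J, T, hJ, hT, hcl⟩ := exists_cover_mk_opClosure_le hG hk hmu f
  have hemb : ∀ b : I, Nonempty (Iio b ↪ mu.ord.ToType) := by
    intro b
    rw [← Cardinal.le_def, mk_toType, card_ord]
    exact mk_Iio_succOrd_le b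
  let emb := fun b => (hemb b).some
  -- `G Y j` adds to `Y` those predecessors of its elements that are coded in the piece `T j`; `F Y
  -- j` is its closure, pulled back to indices.
  let G : Set I → J → Set I := fun Y j => Y ∪ ⋃ b : Y, {x | ∃ h : x < b.1, emb b.1 ⟨x, h⟩ ∈ T j}
  let F : Set I → J → Set I := fun Y j => a ⁻¹' opClosure f kap (a '' G Y j)
  have hGF : ∀ (Y : Set I) j, G Y j ⊆ F Y j := fun Y j x hx => subset_opClosure _ (mem_image_of_mem a hx)
  have hFmono : ∀ {Y Y' : Set I} j, Y ⊆ Y' → F Y j ⊆ F Y' j := by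
    intro Y Y' j h
    refine preimage_mono (opClosure_mono (image_mono (union_subset_union h ?_)))
    exact iUnion_subset fun b => subset_iUnion
      (fun b : Y' => {x | ∃ h : x < b.1, emb b.1 ⟨x, h⟩ ∈ T j}) ⟨b.1, h b.2⟩
  have haF : ∀ (Y : Set I) j, a '' F Y j = opClosure f kap (a '' G Y j) := by
    intro Y j
    refine image_preimage_eq_of_subset ?_
    rw [haA]
    refine opClosure_subset ?_ hA
    rintro _ ⟨x, -, rfl⟩
    exact (e x).2
  have hFc : ∀ (Y : Set I) j, #Y < kap → #(F Y j) ≤ mu := by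
    intro Y j hY
    rw [← mk_image_eq ha, haF]
    refine hcl j _ (mk_image_le.trans ?_)
    have hm : ℵ₀ ≤ max kap #(T j) := hk.aleph0_le.trans (le_max_left _ _)
    have hY' : #Y ≤ max kap #(T j) := hY.le.trans (le_max_left _ _)
    refine (mk_union_le _ _).trans (add_le_of_le hm hY' ((mk_iUnion_le _).trans ?_))
    refine mul_le_of_le hm hY' (ciSup_le' fun b => le_trans ?_ (le_max_right _ _))
    refine mk_le_of_injective (f := fun x => (⟨emb b.1 ⟨x.1, x.2.choose⟩, x.2.choose_spec⟩ : T j)) ?_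
    intro x y hxy
    have h1 := (emb b.1).injective (Subtype.ext_iff.1 hxy)
    exact Subtype.ext (congrArg (fun t : Iio b.1 => t.1) h1)
  obtain ⟨C, D, hD, hC⟩ := hV
  -- `h x` lies beyond a point of `D` above `x` and beyond all `F (C x) j` when `C x` is small.
  -- Hence closure points of `h` are limits of `D` and absorb these closures.
  have hh : ∀ x : I, ∃ w, (∃ d ∈ D, x < d ∧ d < w) ∧ (#(C x) < kap → ∀ j, ∀ y ∈ F (C x) j, y < w) := by
    intro x
    obtain ⟨z, hz⟩ := exists_gt_of_aleph0_le_cof (I := I)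
      (by rw [hcofI]; exact hmu0.trans (Order.le_succ mu)) x
    obtain ⟨d, hd, hzd⟩ := hD.isCofinal z
    by_cases hx : #(C x) < kap
    · have hc : #(insert d (⋃ j, F (C x) j) : Set I) < Order.cof I := by
        rw [hcofI, Order.lt_succ_iff]
        refine mk_insert_le.trans (add_le_of_le hmu0 ((mk_iUnion_le _).trans ?_)
          (one_le_aleph0.trans hmu0))
        exact mul_le_of_le hmu0 (hJ.le.trans hmu) (ciSup_le' fun j => hFc _ j hx)
      obtain ⟨w, hw⟩ := exists_forall_lt_of_mk_lt_cof hc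
      exact ⟨w, ⟨d, hd, hz.trans_le hzd, hw _ (mem_insert _ _)⟩,
        fun _ j y hy => hw _ (mem_insert_of_mem _ (mem_iUnion.2 ⟨j, hy⟩))⟩
    · obtain ⟨w, hw⟩ := exists_gt_of_aleph0_le_cof (I := I)
        (by rw [hcofI]; exact hmu0.trans (Order.le_succ mu)) d
      exact ⟨w, ⟨d, hd, hz.trans_le hzd, hw⟩, fun h => absurd h hx⟩
  choose h hhD hhF using hh
  let S : Set I := {x | (∀ y < x, h y < x) ∧ kap ≤ Order.cof (Iio x)}
  have hSD : ∀ x ∈ S, x ∈ D := by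
    rintro x ⟨hx, hxc⟩
    have hne : Nonempty (Iio x) := by
      rw [← Order.cof_ne_zero_iff]
      exact (hk.pos.trans_le hxc).ne'
    refine hD.isLUB_mem (t := D ∩ Iio x) inter_subset_left ?_ ⟨fun y hy => hy.2.le, ?_⟩
    · obtain ⟨y, hy⟩ := hne
      obtain ⟨d, hd, -, hdh⟩ := hhD y
      exact ⟨d, hd, hdh.trans (hx y hy)⟩
    · intro z hz
      by_contra! hzx
      obtain ⟨d, hd, hzd, hdh⟩ := hhD z
      exact hzd.not_ge (hz ⟨hd, hdh.trans (hx z hzx)⟩)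
  -- These unions are closed because fewer than `κ` small subsets of `C x` have a small union. They
  -- stay below `x` because each `Y` lies in some small `C z` with `z < x`.
  let N : I → J → Set I := fun x j => ⋃ Y : {Y : Set I // Y ⊆ C x ∧ #Y < kap}, F Y.1 j
  have hNcl : ∀ x j, IsClosedUnder f kap (a '' N x j) := by
    intro x j Z hZ hZc
    have h1 : ∀ z : Z, ∃ Y : Set I, (Y ⊆ C x ∧ #Y < kap) ∧ z.1 ∈ a '' F Y j := by
      intro z
      obtain ⟨y, hy, hyz⟩ := hZ z.2
      obtain ⟨Y, hY⟩ := mem_iUnion.1 hy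
      exact ⟨Y.1, Y.2, y, hY, hyz⟩
    choose Y hY hzY using h1
    have hU : #(⋃ z, Y z) < kap :=
      (card_iUnion_lt_iff_forall_of_isRegular hk hZc).2 fun z => (hY z).2
    have h2 : f Z ∈ a '' F (⋃ z, Y z) j := by
      rw [haF]
      refine isClosedUnder_opClosure _ Z (fun z hz => ?_) hZc
      rw [← haF]
      exact image_mono (hFmono j (subset_iUnion Y ⟨z, hz⟩)) (hzY ⟨z, hz⟩)
    exact image_mono (subset_iUnion (fun Y : {Y : Set I // Y ⊆ C x ∧ #Y < kap} => F Y.1 j)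
      ⟨_, iUnion_subset fun z => (hY z).1, hU⟩) h2
  have hNU : ∀ x ∈ S, (⋃ j, N x j) = Iio x := by
    intro x hx
    obtain ⟨⟨hC1, hC2, -⟩, hC3⟩ := hC x (hSD x hx) hx.2
    refine Subset.antisymm ?_ fun y hy => ?_
    · refine iUnion_subset fun j => iUnion_subset fun Y y hy => ?_
      obtain ⟨z, hzx, hYz, -, hzc⟩ := hC3 Y.1 Y.2.1 Y.2.2
      exact (hhF z hzc j y (hFmono j hYz hy)).trans (hx.1 z hzx)
    · obtain ⟨d, hd, hyd, hdh⟩ := hhD y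
      obtain ⟨c, hc, hdc⟩ := hC2 d ⟨hdh.trans (hx.1 y hy), hd⟩
      have hyc : y < c := hyd.trans_le hdc
      obtain ⟨j, hj⟩ := hT (emb c ⟨y, hyc⟩)
      have hc1 : #({c} : Set I) < kap := by
        rw [mk_singleton]
        exact one_lt_aleph0.trans_le hk.aleph0_le
      -- The singleton `{c}` suffices: `y < c`, and `j` was chosen so that `T j` contains the code
      -- of `y` below `c`.
      refine mem_iUnion.2 ⟨j, mem_iUnion.2 ⟨⟨{c}, singleton_subset_iff.2 hc, hc1⟩, hGF _ _ ?_⟩⟩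
      exact Or.inr (mem_iUnion.2 ⟨⟨c, rfl⟩, hyc, hj⟩)
  have hNimg : ∀ x ∈ S, a '' Iio x = ⋃₀ range fun j => a '' N x j := by
    intro x hx
    rw [← hNU x hx, image_iUnion, sUnion_range]
  have hsmall : ∀ x ∈ S, IsSmallUnion f kap (a '' Iio x) := by
    intro x hx
    refine ⟨range fun j => a '' N x j, mk_range_le.trans_lt hJ, ?_, (hNimg x hx).symm⟩
    rintro _ ⟨j, rfl⟩
    exact hNcl x j
  have hlay : ∀ x ∈ S, HasLayering f kap (a '' Iio x) := by
    intro x hx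
    rw [hNimg x hx]
    refine HasLayering.sUnion hk (mk_range_le.trans_lt hJ) ?_ ?_
    · rintro _ ⟨j, rfl⟩
      exact hNcl x j
    · rintro _ ⟨j, rfl⟩
      refine ih _ (mk_image_le.trans ((mk_le_mk_of_subset ?_).trans (mk_Iio_succOrd_le x))) (hNcl x j)
      rw [← hNU x hx]
      exact subset_iUnion _ j
  have hcover : A = ⋃ x : S, a '' Iio x.1 := by
    refine Subset.antisymm (fun b hb => ?_) (iUnion_subset fun x => ?_)
    · rw [← haA] at hb
      obtain ⟨i, rfl⟩ := hb
      obtain ⟨x, hix, hx1, hx2⟩ := exists_closed_le_cof (I := I) hk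
        (by rw [hcofI]; exact Order.lt_succ_iff.2 hmu)
        (fun z => by
          rw [hcofI]; exact mk_Iic_lt_of_ord_toType (hmu0.trans (Order.le_succ mu)) z) h i
      exact mem_iUnion.2 ⟨⟨x, hx1, hx2⟩, mem_image_of_mem a hix⟩
    · rw [← haA]
      exact image_subset_range _ _
  rw [hcover]
  refine HasLayering.iUnion hk (fun x => hlay x.1 x.2) fun x => ?_
  -- `S` is closed only under suprema of cofinality at least `κ`. For smaller cofinality, a cofinal
  -- family of fewer than `κ` segments replaces the missing supremum.
  rcases lt_or_ge (Order.cof (Iio x)) kap with hlt | hge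
  · exact isSmallUnion_iUnion_of_cof_lt hk hlt
      (fun y z hyz => image_mono (Iio_subset_Iio (show y.1.1 ≤ z.1.1 from hyz))) fun y =>
      hsmall y.1.1 y.1.2
  · let W : Set I := S ∩ Iio x.1
    let g : Iio x → W := fun y => ⟨y.1.1, y.1.2, y.2⟩
    have hg : StrictMono g := fun y z hyz => hyz
    have hgs : Function.Surjective g := fun w => ⟨⟨⟨w.1, w.2.1⟩, w.2.2⟩, rfl⟩
    have hWc : kap ≤ Order.cof W := by
      rw [← Order.cof_congr_of_strictMono hg (by rw [hgs.range_eq]; exact .univ)]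
      exact hge
    obtain ⟨d, hd1, hd2, hd3⟩ := exists_lub_le_cof hk.aleph0_le hWc ⟨x.1, fun w hw => hw.2.le⟩
    have hdS : d ∈ S := by
      refine ⟨fun y hy => ?_, hd3⟩
      obtain ⟨w, hw, hyw⟩ := hd2 y hy
      exact (hw.1.1 y hyw).trans (hd1 w hw)
    have : (⋃ y : Iio x, a '' Iio y.1.1) = a '' Iio d := by
      rw [← image_iUnion]
      congr 1
      ext y
      constructor
      · intro hy
        obtain ⟨w, hw⟩ := mem_iUnion.1 hy
        exact lt_trans hw (hd1 _ (g w).2)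
      · intro hy
        obtain ⟨w, hw, hyw⟩ := hd2 y hy
        exact mem_iUnion.2 ⟨⟨⟨w, hw.1⟩, hw.2⟩, hyw⟩
    rw [this]
    exact hsmall d hdS

/-- Under `GCH` and `VWS`, every closed set has a layering. -/
theorem hasLayering (hG : GCH.{u}) (hV : VWS.{u}) (hk : kap.IsRegular) {A : Set B}
    (hA : IsClosedUnder f kap A) : HasLayering f kap A := by
  induction h : #A using WellFoundedLT.induction generalizing A with | ind nu ih =>
  subst h
  rcases le_or_gt #A kap with hle | hgt
  · exact hasLayering_of_mk_le hk hle
  by_cases hlim : ∀ c < #A, Order.succ c < #A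
  · exact hasLayering_of_isSuccPrelimit hG hk hA hgt hlim fun A' h hA' => ih _ h hA' rfl
  · push Not at hlim
    obtain ⟨mu, hmu, hmu'⟩ := hlim
    have hs : #A = Order.succ mu := hmu'.antisymm (Order.succ_le_of_lt hmu)
    have hkmu : kap ≤ mu := Order.lt_succ_iff.1 (hs ▸ hgt)
    exact hasLayering_of_succ hG hk hkmu (hV mu kap kap le_rfl hkmu hk hk) hA hs
      fun A' h hA' => ih _ (h.trans_lt hmu) hA' rfl

end Layering

/-! ### Regular subsets of a poset -/

section Posets

variable {P : Type u} [PartialOrder P]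

theorem PosetCompatible.symm {p q : P} (h : PosetCompatible p q) : PosetCompatible q p := by
  obtain ⟨r, hp, hq⟩ := h
  exact ⟨r, hq, hp⟩

theorem PosetCompatible.refl (p : P) : PosetCompatible p p := ⟨p, le_rfl, le_rfl⟩

theorem PosetCompatible.mono {p q p' q' : P} (hp : p ≤ p') (hq : q ≤ q')
    (h : PosetCompatible p q) : PosetCompatible p' q' := by
  obtain ⟨r, h1, h2⟩ := h
  exact ⟨r, h1.trans hp, h2.trans hq⟩

/-- A set of pairwise incompatible elements. -/
def IsIncompatibleSet (A : Set P) : Prop := A.Pairwise fun p q => ¬ PosetCompatible p q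

theorem exists_maximal_incompatible (W : Set P) :
    ∃ M ⊆ W, IsIncompatibleSet M ∧ ∀ w ∈ W, ∃ m ∈ M, PosetCompatible w m := by
  obtain ⟨M, hM⟩ := zorn_subset {M : Set P | M ⊆ W ∧ IsIncompatibleSet M} (by
    intro c hc hchain
    refine ⟨⋃₀ c, ⟨sUnion_subset fun s hs => (hc hs).1, ?_⟩, fun s hs => subset_sUnion_of_mem hs⟩
    exact (pairwise_sUnion hchain.directedOn).2 fun s hs => (hc hs).2)
  refine ⟨M, hM.prop.1, hM.prop.2, fun w hw => ?_⟩
  by_contra! hc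
  have h1 : insert w M ∈ {M : Set P | M ⊆ W ∧ IsIncompatibleSet M} := by
    refine ⟨insert_subset hw hM.prop.1, hM.prop.2.insert fun m hm _ => ⟨hc m hm, fun h => ?_⟩⟩
    exact hc m hm h.symm
  exact hc w (hM.le_of_ge h1 (subset_insert w M) (mem_insert w M)) (.refl w)

/-- The elements incompatible with all elements of `X`. -/
def incompatibles (X : Set P) : Set P := {q | ∀ x ∈ X, ¬ PosetCompatible q x}

theorem incompatibles_anti {X Y : Set P} (h : X ⊆ Y) : incompatibles Y ⊆ incompatibles X :=
  fun _ hq x hx => hq x (h hx)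

theorem isLowerSet_incompatibles (X : Set P) : IsLowerSet (incompatibles X) :=
  fun _ _ hba ha x hx h => ha x hx (h.mono hba le_rfl)

theorem subset_incompatibles_incompatibles (X : Set P) : X ⊆ incompatibles (incompatibles X) :=
  fun _ hx _ hy h => hy _ hx h.symm

/-- Regular sets, the elements of the completion of `P`. -/
def IsRegularSet (X : Set P) : Prop := incompatibles (incompatibles X) = X

theorem IsRegularSet.isLowerSet {X : Set P} (hX : IsRegularSet X) : IsLowerSet X :=
  hX ▸ isLowerSet_incompatibles _

theorem isRegularSet_sInter {Y : Set (Set P)} (hY : ∀ X ∈ Y, IsRegularSet X) :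
    IsRegularSet (⋂₀ Y) := by
  refine Subset.antisymm (subset_sInter fun X hX => ?_) (subset_incompatibles_incompatibles _)
  exact (incompatibles_anti (incompatibles_anti (sInter_subset_of_mem hX))).trans (hY X hX).subset

theorem IsSeparative.isRegularSet_Iic (hP : IsSeparative P) (p : P) : IsRegularSet (Iic p) := by
  refine Subset.antisymm (fun q hq => ?_) (subset_incompatibles_incompatibles _)
  by_contra hqp
  obtain ⟨r, hrq, hrp⟩ := hP p q hqp
  refine hq r (fun x hx h => hrp (h.mono le_rfl hx)) ⟨r, hrq, le_rfl⟩

/-- Take a maximal incompatible set of elements that are each incompatible with some member of `F`,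
and keep one such member for each. An element of the smaller intersection outside some `Z ∈ F` would
have an extension incompatible with `Z`, contradicting maximality. -/
theorem HasCC.exists_sInter_eq {kap : Cardinal.{u}} (hcc : HasCC P kap) {F : Set (Set P)}
    (hF : ∀ X ∈ F, IsRegularSet X) : ∃ F' ⊆ F, #F' < kap ∧ ⋂₀ F' = ⋂₀ F := by
  obtain ⟨M, hMW, hM, hmax⟩ := exists_maximal_incompatible {q : P | ∃ X ∈ F, q ∈ incompatibles X}
  choose X hX hXm using fun m : M => hMW m.2
  refine ⟨range X, by rintro _ ⟨m, rfl⟩; exact hX m, mk_range_le.trans_lt (hcc M hM), ?_⟩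
  refine Subset.antisymm (fun q hq => ?_)
    (sInter_subset_sInter (by rintro _ ⟨m, rfl⟩; exact hX m))
  intro Z hZ
  rw [← hF Z hZ]
  intro w hw ⟨s, hsq, hsw⟩
  have hs : ∃ X ∈ F, s ∈ incompatibles X := ⟨Z, hZ, isLowerSet_incompatibles _ hsw hw⟩
  obtain ⟨m, hm, t, hts, htm⟩ := hmax s hs
  have h1 : t ∈ X ⟨m, hm⟩ :=
    (hF _ (hX ⟨m, hm⟩)).isLowerSet (hts.trans hsq) (hq _ (mem_range_self (⟨m, hm⟩ : M)))
  have h2 : t ∈ incompatibles (X ⟨m, hm⟩) := isLowerSet_incompatibles _ htm (hXm ⟨m, hm⟩)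
  exact h2 t h1 (.refl t)

/-- The crucial case of `▽`. -/
theorem exists_dense_of_hasCC (hG : GCH.{u}) (hV : VWS.{u}) (hP : IsSeparative P)
    {kap : Cardinal.{u}} (hk : kap.IsRegular) (hcc : HasCC P kap) :
    ∃ D : Set P, IsDenseSubset D ∧ ∀ q, #{p | p ∈ D ∧ q ≤ p} < kap := by
  let A : Set (Set P) := {X | IsRegularSet X}
  have hA : IsClosedUnder (fun Y : Set (Set P) => ⋂₀ Y) kap A :=
    fun Y hY _ => isRegularSet_sInter hY
  obtain ⟨L, _, _, r, hr, hrc⟩ := hasLayering hG hV hk hA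
  let K := kap.ord.ToType
  have hK : #K = kap := by rw [mk_toType, card_ord]
  have hemb : ∀ l, Nonempty ({x | x ∈ A ∧ r x = l} ↪ K) := fun l => by
    rw [← Cardinal.le_def, hK]
    exact hrc l
  let emb := fun l => (hemb l).some
  have hKne : Nonempty K := by
    rw [← mk_ne_zero_iff, hK]
    exact hk.ne_zero
  classical
  let idx : Set P → K := fun x => if h : x ∈ A then emb (r x) ⟨x, h, rfl⟩ else hKne.some
  have hidx : ∀ x ∈ A, ∀ y ∈ A, r x = r y → idx x = idx y → x = y := by
    intro x hx y hy hxy h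
    simp only [idx, dif_pos hx, dif_pos hy] at h
    have : ∀ l (hl : r y = l), emb (r x) ⟨x, hx, rfl⟩ = emb l ⟨y, hy, hl⟩ → r x = l → x = y := by
      rintro l hl h rfl
      exact congrArg Subtype.val ((emb _).injective h)
    exact this _ rfl h hxy
  -- An injective well-ordered ranking of `A`: layer first, then index within the layer. `Dr` keeps
  -- the nonempty sets of least rank among their nonempty regular subsets.
  let rho : Set P → L ×ₗ K := fun x => toLex (r x, idx x)
  let Dr : Set (Set P) := {d | d ∈ A ∧ d.Nonempty ∧ ∀ x ∈ A, x.Nonempty → x ⊆ d → rho d ≤ rho x}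
  -- A kept `d ⊇ b` has rank at most that of `b`. Fewer than `κ` of these are in the layer of `b`;
  -- the others lie in one of fewer than `κ` closed sets `S` of lower layers and contain the least
  -- member of `S` above `b`, to which induction applies.
  have hcount : ∀ l, ∀ b ∈ A, b.Nonempty → r b = l → #{d | d ∈ Dr ∧ b ⊆ d} < kap := by
    intro l
    induction l using WellFoundedLT.induction with | ind l ih =>
    intro b hb hbne hbl
    obtain ⟨N, hNc, hN, hNU⟩ := hr l
    have hsub : {d | d ∈ Dr ∧ b ⊆ d} ⊆ {d | d ∈ A ∧ r d = l ∧ idx d ≤ idx b} ∪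
        ⋃ S : N, {d | d ∈ Dr ∧ ⋂₀ {x | x ∈ S.1 ∧ b ⊆ x} ⊆ d} := by
      rintro d ⟨hd, hbd⟩
      rcases Prod.Lex.toLex_le_toLex.1 (hd.2.2 b hb hbne hbd) with h | ⟨h1, h2⟩
      · have h3 : d ∈ ⋃₀ N := hNU ▸ ⟨hd.1, hbl ▸ h⟩
        obtain ⟨S, hS, hdS⟩ := h3
        exact Or.inr (mem_iUnion.2 ⟨⟨S, hS⟩, hd, sInter_subset_of_mem ⟨hdS, hbd⟩⟩)
      · exact Or.inl ⟨hd.1, h1.trans hbl, h2⟩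
    refine (mk_le_mk_of_subset hsub).trans_lt ((mk_union_le _ _).trans_lt
      (add_lt_of_lt hk.aleph0_le ?_ ?_))
    · refine lt_of_le_of_lt ?_ (mk_Iic_lt_of_ord_toType hk.aleph0_le (idx b))
      refine mk_le_of_injective (f := fun d => (⟨idx d.1, d.2.2.2⟩ : Iic (idx b))) fun d d' h => ?_
      exact Subtype.ext (hidx _ d.2.1 _ d'.2.1 (d.2.2.1.trans d'.2.2.1.symm)
        (congrArg Subtype.val h))
    · refine (card_iUnion_lt_iff_forall_of_isRegular hk hNc).2 fun S => ?_
      have hSA : ∀ x ∈ S.1, x ∈ A ∧ r x < l := fun x hx => by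
        have : x ∈ ⋃₀ N := ⟨S.1, S.2, hx⟩
        rwa [hNU] at this
      obtain ⟨F, hF, hFc, hFe⟩ := hcc.exists_sInter_eq (F := {x | x ∈ S.1 ∧ b ⊆ x})
        fun x hx => (hSA x hx.1).1
      -- `S` is only closed under intersections of fewer than `κ` sets; the chain condition reduces
      -- the full intersection to one of these.
      have hmem : ⋂₀ {x | x ∈ S.1 ∧ b ⊆ x} ∈ S.1 := by
        rw [← hFe]
        exact hN S.1 S.2 F (fun x hx => (hF hx).1) hFc
      have hbs : b ⊆ ⋂₀ {x | x ∈ S.1 ∧ b ⊆ x} := subset_sInter fun x hx => hx.2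
      exact ih _ (hSA _ hmem).2 _ (hSA _ hmem).1 (hbne.mono hbs) rfl
  choose pt hpt using fun d : Dr => d.2.2.1
  refine ⟨range pt, fun p => ?_, fun q => ?_⟩
  · have wf : WellFounded ((· < ·) : L ×ₗ K → L ×ₗ K → Prop) := wellFounded_lt
    have hne : {x : Set P | x ∈ A ∧ x.Nonempty ∧ x ⊆ Iic p}.Nonempty :=
      ⟨Iic p, hP.isRegularSet_Iic p, nonempty_Iic, Subset.rfl⟩
    have wf' := InvImage.wf rho wf
    have hm := wf'.min_mem _ hne
    set d := wf'.min _ hne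
    have hd : d ∈ Dr := by
      refine ⟨hm.1, hm.2.1, fun x hx hxne hxd => ?_⟩
      exact not_lt.1 (wf'.not_lt_min {x : Set P | x ∈ A ∧ x.Nonempty ∧ x ⊆ Iic p}
        ⟨hx, hxne, hxd.trans hm.2.2⟩)
    exact ⟨pt ⟨d, hd⟩, mem_range_self _, hm.2.2 (hpt ⟨d, hd⟩)⟩
  · refine lt_of_le_of_lt ?_
      (hcount _ (Iic q) (hP.isRegularSet_Iic q) nonempty_Iic rfl)
    have hsub : {p | p ∈ range pt ∧ q ≤ p} ⊆
        range fun d : {d | d ∈ Dr ∧ Iic q ⊆ d} => pt ⟨d.1, d.2.1⟩ := by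
      rintro _ ⟨⟨d, rfl⟩, hq⟩
      exact ⟨⟨d.1, d.2, fun x hx => d.2.1.isLowerSet (le_trans hx hq) (hpt d)⟩, rfl⟩
    exact (mk_le_mk_of_subset hsub).trans mk_range_le

/-! ### Local Souslin numbers -/

/-- The least `c` such that all sets of pairwise incompatible extensions of `p` have size less
than `c`. -/
noncomputable def localSouslin (p : P) : Cardinal.{u} :=
  sInf {c | ∀ A ⊆ Iic p, IsIncompatibleSet A → #A < c}

theorem mk_lt_localSouslin {p : P} {A : Set P} (hA : A ⊆ Iic p) (h : IsIncompatibleSet A) :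
    #A < localSouslin p := by
  have hne : {c : Cardinal.{u} | ∀ A ⊆ Iic p, IsIncompatibleSet A → #A < c}.Nonempty :=
    ⟨Order.succ #P, fun A _ _ => Order.lt_succ_of_le (mk_set_le A)⟩
  exact csInf_mem hne A hA h

theorem exists_incompatible_of_lt_localSouslin {p : P} {c : Cardinal.{u}}
    (hc : c < localSouslin p) : ∃ A ⊆ Iic p, IsIncompatibleSet A ∧ #A = c := by
  have h := notMem_of_lt_csInf' hc
  simp only [mem_ofPred_eq, not_forall, not_lt] at h
  obtain ⟨A, hA, hAi, hcA⟩ := h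
  obtain ⟨A', hA', rfl⟩ := le_mk_iff_exists_subset.1 hcA
  exact ⟨A', hA'.trans hA, hAi.mono hA', rfl⟩

theorem localSouslin_mono {p q : P} (h : q ≤ p) : localSouslin q ≤ localSouslin p :=
  csInf_le' fun _ hA hAi => mk_lt_localSouslin (hA.trans (Iic_subset_Iic.2 h)) hAi

theorem localSouslin_le_souslinNumber (p : P) : localSouslin p ≤ souslinNumber P := by
  have hne : {c : Cardinal.{u} | HasCC P c}.Nonempty :=
    ⟨Order.succ #P, fun A _ => Order.lt_succ_of_le (mk_set_le A)⟩
  exact csInf_le' fun A _ hAi => csInf_mem hne A hAi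

/-- All extensions of `p` have the same local Souslin number. -/
def IsSouslinHomogeneous (p : P) : Prop := ∀ q ≤ p, localSouslin q = localSouslin p

theorem exists_le_isSouslinHomogeneous (p : P) : ∃ q ≤ p, IsSouslinHomogeneous q := by
  have wf := InvImage.wf (localSouslin : P → Cardinal.{u}) wellFounded_lt
  have hne : (Iic p).Nonempty := nonempty_Iic
  refine ⟨wf.min (Iic p) hne, wf.min_mem (Iic p) hne, fun q hq => ?_⟩
  exact (localSouslin_mono hq).antisymm
    (not_lt.1 (wf.not_lt_min (Iic p) (hq.trans (wf.min_mem (Iic p) hne))))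

/-- Below each `a ∈ A` homogeneity provides an incompatible set of size `c a`; together these form
one incompatible set below `p`. -/
theorem IsSouslinHomogeneous.sum_lt {p : P} (hp : IsSouslinHomogeneous p) {A : Set P}
    (hA : A ⊆ Iic p) (hAi : IsIncompatibleSet A) {c : A → Cardinal.{u}}
    (hc : ∀ a, c a < localSouslin p) : sum c < localSouslin p := by
  have h1 : ∀ a : A, ∃ B ⊆ Iic a.1, IsIncompatibleSet B ∧ #B = c a := fun a =>
    exists_incompatible_of_lt_localSouslin (by rw [hp _ (hA a.2)]; exact hc a)
  choose B hB hBi hBc using h1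
  have hinc : ∀ a b : A, a ≠ b → ∀ x ∈ B a, ∀ y ∈ B b, ¬ PosetCompatible x y :=
    fun a b hab x hx y hy h =>
      hAi a.2 b.2 (fun h => hab (Subtype.ext h)) (h.mono (hB a hx) (hB b hy))
  have hdis : Pairwise fun a b => Disjoint (B a) (B b) := fun a b hab =>
    disjoint_left.2 fun x hx hy => hinc a b hab x hx x hy (.refl x)
  have hU : #(⋃ a, B a) = sum c := by
    rw [mk_iUnion_eq_sum_mk hdis]
    simp only [hBc]
  rw [← hU]
  refine mk_lt_localSouslin (iUnion_subset fun a => (hB a).trans (Iic_subset_Iic.2 (hA a.2))) ?_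
  intro x hx y hy hxy
  obtain ⟨a, ha⟩ := mem_iUnion.1 hx
  obtain ⟨b, hb⟩ := mem_iUnion.1 hy
  by_cases hab : a = b
  · subst hab
    exact hBi a ha hb hxy
  · exact hinc a b hab x ha y hb

theorem isMin_of_forall_compatible (hP : IsSeparative P) {p : P}
    (h : ∀ x ≤ p, ∀ y ≤ p, PosetCompatible x y) : IsMin p := by
  intro r hr
  by_contra hpr
  obtain ⟨t, htp, ht⟩ := hP r p hpr
  exact ht (h t htp r hr)

/-- Homogeneity allows splitting again and again, and the sides left behind form an infinite
incompatible set. A singular value would be a sum excluded by `sum_lt`. -/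
theorem IsSouslinHomogeneous.isRegular {p : P} (hp : IsSouslinHomogeneous p) {x y : P}
    (hx : x ≤ p) (hy : y ≤ p) (hxy : ¬ PosetCompatible x y) :
    (localSouslin p).IsRegular ∧ ℵ₀ < localSouslin p := by
  have h2 : 2 < localSouslin p := by
    have hne : x ≠ y := fun h => hxy (h ▸ .refl x)
    have : #({x, y} : Set P) = 2 := by
      rw [mk_insert (by simpa using hne), mk_singleton, one_add_one_eq_two]
    rw [← this]
    refine mk_lt_localSouslin (insert_subset hx (singleton_subset_iff.2 hy)) ?_
    exact pairwise_pair.2 fun _ => ⟨hxy, fun h => hxy h.symm⟩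
  have hsplit : ∀ q : Iic p, ∃ a : Iic p × Iic p, a.1.1 ≤ q.1 ∧ a.2.1 ≤ q.1 ∧
      ¬ PosetCompatible a.1.1 a.2.1 := by
    intro q
    obtain ⟨A, hA, hAi, hAc⟩ := exists_incompatible_of_lt_localSouslin
      (p := q.1) (c := 2) (by rw [hp _ q.2]; exact h2)
    obtain ⟨a, b, hab, -⟩ := mk_eq_two_iff.1 hAc
    exact ⟨⟨⟨a, (hA a.2).trans q.2⟩, ⟨b, (hA b.2).trans q.2⟩⟩, hA a.2, hA b.2,
      hAi a.2 b.2 fun h => hab (Subtype.ext h)⟩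
  choose a ha1 ha2 ha3 using hsplit
  let t : ℕ → Iic p := fun n => Nat.rec ⟨p, le_rfl⟩ (fun _ q => (a q).2) n
  have ht : Antitone t := antitone_nat_of_succ_le fun n => ha2 (t n)
  have hinc : ∀ m n, m < n → ¬ PosetCompatible (a (t m)).1.1 (a (t n)).1.1 := fun m n hmn h =>
    ha3 (t m) (h.mono le_rfl ((ha1 (t n)).trans (ht (Nat.succ_le_of_lt hmn))))
  have hinc' : ∀ m n, m ≠ n → ¬ PosetCompatible (a (t m)).1.1 (a (t n)).1.1 := fun m n hmn h => by
    rcases lt_or_gt_of_ne hmn with h' | h'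
    exacts [hinc m n h' h, hinc n m h' h.symm]
  have hinf : ℵ₀ < localSouslin p := by
    have hinj : Function.Injective fun n => (a (t n)).1.1 := fun m n hmn => by
      by_contra hne
      exact hinc' m n hne (by
        have : (a (t m)).1.1 = (a (t n)).1.1 := hmn
        rw [this]; exact .refl _)
    have : #(range fun n => (a (t n)).1.1) = ℵ₀ := by
      simpa using mk_range_eq_of_injective hinj
    rw [← this]
    refine mk_lt_localSouslin (range_subset_iff.2 fun n => (a (t n)).1.2) ?_
    rintro _ ⟨m, rfl⟩ _ ⟨n, rfl⟩ hne
    exact hinc' m n fun h => hne (by rw [h])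
  refine ⟨⟨hinf.le, ?_⟩, hinf⟩
  by_contra! hcof
  set kap := localSouslin p
  obtain ⟨T, hT, hTc⟩ := Order.exists_cof_eq kap.ord.ToType
  rw [Ordinal.cof_toType] at hTc
  obtain ⟨A, hA, hAi, hAc⟩ := exists_incompatible_of_lt_localSouslin (p := p) (c := #T)
    (hTc.trans_lt hcof)
  obtain ⟨e⟩ := Cardinal.eq.1 hAc
  have h1 := hp.sum_lt hA hAi (c := fun x => #(Iic (e x).1))
    fun x => mk_Iic_lt_of_ord_toType hinf.le _
  have h3 : kap ≤ sum fun x => #(Iic (e x).1) := by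
    calc kap = #(univ : Set kap.ord.ToType) := by rw [mk_univ, mk_toType, card_ord]
      _ ≤ #(⋃ x, Iic (e x).1) := mk_le_mk_of_subset fun z _ => by
          obtain ⟨w, hw, hzw⟩ := hT z
          exact mem_iUnion.2 ⟨e.symm ⟨w, hw⟩, by simpa using hzw⟩
      _ ≤ _ := mk_iUnion_le_sum_mk
  exact h3.not_gt h1

theorem compatible_subtype_iff {p : P} {x y : Iic p} :
    PosetCompatible x y ↔ PosetCompatible x.1 y.1 :=
  ⟨fun ⟨r, h1, h2⟩ => ⟨r.1, h1, h2⟩, fun ⟨r, h1, h2⟩ => ⟨⟨r, h1.trans x.2⟩, h1, h2⟩⟩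

theorem IsSeparative.Iic (hP : IsSeparative P) (p : P) : IsSeparative (Iic p) := by
  intro x y hyx
  obtain ⟨r, hr, hrx⟩ := hP x.1 y.1 hyx
  exact ⟨⟨r, hr.trans y.2⟩, hr, fun h => hrx (compatible_subtype_iff.1 h)⟩

/-- If all extensions of `p` are compatible, separativity makes `p` minimal and `{p}` works.
Otherwise the local Souslin number is regular, and the `κ`-cc case applies to `Iic p`. -/
theorem IsSouslinHomogeneous.exists_dense (hG : GCH.{u}) (hV : VWS.{u}) (hP : IsSeparative P)
    {p : P} (hp : IsSouslinHomogeneous p) :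
    ∃ D ⊆ Iic p, (∀ q ≤ p, ∃ d ∈ D, d ≤ q) ∧ (∀ q ≤ p, #{d | d ∈ D ∧ q ≤ d} < localSouslin p) ∧
      (IsMin p ∨ ℵ₀ < localSouslin p) := by
  by_cases h : ∀ x ≤ p, ∀ y ≤ p, PosetCompatible x y
  · have hmin := isMin_of_forall_compatible hP h
    refine ⟨{p}, singleton_subset_iff.2 le_rfl, fun q hq => ⟨p, rfl, hmin hq⟩, fun q _ => ?_,
      Or.inl hmin⟩
    refine (mk_le_mk_of_subset fun d hd => hd.1).trans_lt ?_
    exact mk_lt_localSouslin (singleton_subset_iff.2 le_rfl) (pairwise_singleton _ _)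
  · push Not at h
    obtain ⟨x, hx, y, hy, hxy⟩ := h
    obtain ⟨hreg, hinf⟩ := hp.isRegular hx hy hxy
    have hcc : HasCC (Iic p) (localSouslin p) := by
      intro A hA
      rw [← mk_image_eq (Subtype.val_injective : Function.Injective (Subtype.val : Iic p → P))]
      refine mk_lt_localSouslin (by rintro _ ⟨a, -, rfl⟩; exact a.2) ?_
      rintro _ ⟨a, ha, rfl⟩ _ ⟨b, hb, rfl⟩ hab hc
      exact hA ha hb (fun h => hab (congrArg _ h)) (compatible_subtype_iff.2 hc)
    obtain ⟨D, hD, hDc⟩ := exists_dense_of_hasCC hG hV (hP.Iic p) hreg hcc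
    refine ⟨Subtype.val '' D, by rintro _ ⟨a, -, rfl⟩; exact a.2, fun q hq => ?_, fun q hq => ?_,
      Or.inr hinf⟩
    · obtain ⟨d, hd, hdq⟩ := hD ⟨q, hq⟩
      exact ⟨d.1, mem_image_of_mem _ hd, hdq⟩
    · have hsub : {d | d ∈ Subtype.val '' D ∧ q ≤ d} ⊆
          Subtype.val '' {d | d ∈ D ∧ (⟨q, hq⟩ : Iic p) ≤ d} := by
        rintro _ ⟨⟨d, hd, rfl⟩, hqd⟩
        exact ⟨d, ⟨hd, hqd⟩, rfl⟩
      exact ((mk_le_mk_of_subset hsub).trans mk_image_le).trans_lt (hDc ⟨q, hq⟩)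

/-- Under `GCH` and `VWS`, a separative poset has a dense subset such that every element extends
fewer elements of it than its local Souslin number. -/
theorem exists_dense_lt_localSouslin (hG : GCH.{u}) (hV : VWS.{u}) (hP : IsSeparative P) :
    ∃ D : Set P, IsDenseSubset D ∧ (∀ q, #{d | d ∈ D ∧ q ≤ d} < localSouslin q) ∧
      ∀ q ∈ D, IsMin q ∨ ℵ₀ < localSouslin q := by
  obtain ⟨M, hMH, hM, hmax⟩ := exists_maximal_incompatible {p : P | IsSouslinHomogeneous p}
  choose D hDsub hDd hDc hDi using fun m : M =>
    (hMH m.2 : IsSouslinHomogeneous m.1).exists_dense hG hV hP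
  refine ⟨⋃ m, D m, fun p => ?_, fun q => ?_, fun q hq => ?_⟩
  · obtain ⟨h, hhp, hh⟩ := exists_le_isSouslinHomogeneous p
    obtain ⟨m, hm, t, hth, htm⟩ := hmax h hh
    obtain ⟨d, hd, hdt⟩ := hDd ⟨m, hm⟩ t htm
    exact ⟨d, mem_iUnion.2 ⟨_, hd⟩, hdt.trans (hth.trans hhp)⟩
  · by_cases hq : ∃ m : M, q ≤ m.1
    · obtain ⟨m, hm⟩ := hq
      rw [hMH m.2 q hm]
      refine (mk_le_mk_of_subset ?_).trans_lt (hDc m q hm)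
      rintro d ⟨hd, hqd⟩
      obtain ⟨m', hd'⟩ := mem_iUnion.1 hd
      -- An element below `m` extends nothing in `D m'` for `m' ≠ m`, so the counts for different
      -- `m` do not add up.
      have : m' = m := by
        by_contra hne
        exact hM m'.2 m.2 (fun h => hne (Subtype.ext h)) ⟨q, hqd.trans (hDsub m' hd'), hm⟩
      exact ⟨this ▸ hd', hqd⟩
    · have : {d | d ∈ ⋃ m, D m ∧ q ≤ d} = ∅ := by
        refine eq_empty_of_forall_notMem fun d hd => hq ?_
        obtain ⟨m, hm⟩ := mem_iUnion.1 hd.1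
        exact ⟨m, hd.2.trans (hDsub m hm)⟩
      rw [this]
      exact mk_lt_localSouslin (empty_subset _) (pairwise_empty _)
  · obtain ⟨m, hm⟩ := mem_iUnion.1 hq
    rcases hDi m with h | h
    · exact Or.inl fun r hr => (hDsub m hm).trans (h (hr.trans (hDsub m hm)))
    · exact Or.inr (by rwa [hMH m.2 q (hDsub m hm)])

end Posets

/-! ### From the local bound to `▽`. -/

theorem nabla_of_vws (hG : GCH.{u}) (hV : VWS.{u}) : Nabla.{u} := by
  intro P _ hP
  obtain ⟨D, hD, hDc, -⟩ := exists_dense_lt_localSouslin hG hV hP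
  have h : piNoetherianType P ≤ noetherianType D := csInf_le' ⟨D, hD, rfl⟩
  refine h.trans (csInf_le' fun q => ?_)
  exact (hDc q).trans_le (localSouslin_le_souslinNumber q)

/-! ### Regular open sets -/

section RegularOpen

variable {X : Type u} [TopologicalSpace X]

variable (X) in
/-- Nonempty regular open sets. -/
abbrev NonemptyRegularOpen : Type u := {U : NonemptyOpen X // interior (closure U.1) = U.1}

theorem interior_closure_interior_closure (s : Set X) :
    interior (closure (interior (closure s))) = interior (closure s) :=
  Subset.antisymm (interior_mono (closure_minimal interior_subset isClosed_closure))
    (interior_maximal subset_closure isOpen_interior)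

theorem IsQuasiRegular.exists_le (hX : IsQuasiRegular X) (U : NonemptyOpen X) :
    ∃ V : NonemptyRegularOpen X, V.1 ≤ U := by
  obtain ⟨V, hV, hVne, hVU⟩ := hX.2 U.1 U.2.1 U.2.2
  exact ⟨⟨⟨interior (closure V), isOpen_interior, hVne.mono (interior_maximal subset_closure hV)⟩,
    interior_closure_interior_closure V⟩, interior_subset.trans hVU⟩

/-- The witness is `q` minus the closure of `p`: it is nonempty because `p` is the interior of its
closure, and it is again regular open. -/
theorem isSeparative_nonemptyRegularOpen : IsSeparative (NonemptyRegularOpen X) := by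
  intro p q hqp
  have hne : (q.1.1 ∩ (closure p.1.1)ᶜ).Nonempty := by
    rw [nonempty_iff_ne_empty]
    intro h
    refine hqp (show q.1.1 ⊆ p.1.1 from ?_)
    rw [← p.2]
    exact interior_maximal (sdiff_eq_empty.1 h) q.1.2.1
  have hreg : interior (closure (q.1.1 ∩ (closure p.1.1)ᶜ)) = q.1.1 ∩ (closure p.1.1)ᶜ := by
    refine Subset.antisymm (subset_inter ?_ ?_)
      (interior_maximal subset_closure (q.1.2.1.inter isClosed_closure.isOpen_compl))
    · conv_rhs => rw [← q.2]
      exact interior_mono (closure_mono inter_subset_left)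
    · rw [← interior_compl]
      refine interior_mono ((closure_mono inter_subset_right).trans ?_)
      rw [interior_compl, closure_compl, p.2]
  refine ⟨⟨⟨q.1.1 ∩ (closure p.1.1)ᶜ, q.1.2.1.inter isClosed_closure.isOpen_compl, hne⟩, hreg⟩,
    (inter_subset_left : q.1.1 ∩ (closure p.1.1)ᶜ ⊆ q.1.1), ?_⟩
  rintro ⟨r, h1, h2⟩
  obtain ⟨x, hx⟩ := r.1.2.2
  have h1' : r.1.1 ⊆ q.1.1 ∩ (closure p.1.1)ᶜ := h1
  have h2' : r.1.1 ⊆ p.1.1 := h2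
  exact (h1' hx).2 (subset_closure (h2' hx))

end RegularOpen

/-! ### Coding lists -/

theorem exists_list_code {P : Type u} [PartialOrder P] {D : Set P}
    (hD : ∀ q, #{d | d ∈ D ∧ q ≤ d} < localSouslin q)
    (hD' : ∀ q ∈ D, IsMin q ∨ ℵ₀ < localSouslin q) :
    ∃ c : P → List P → P, (∀ w l, c w l ≤ w) ∧ ∀ w ∈ D, IsMin w ∨ ∀ l l' : List P,
      (∀ x ∈ l, x ∈ D ∧ w ≤ x) → (∀ x ∈ l', x ∈ D ∧ w ≤ x) →
        PosetCompatible (c w l) (c w l') → l = l' := by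
  have key : ∀ w : P, ∃ g : List P → P, (∀ l, g l ≤ w) ∧ (w ∈ D → IsMin w ∨ ∀ l l' : List P,
      (∀ x ∈ l, x ∈ D ∧ w ≤ x) → (∀ x ∈ l', x ∈ D ∧ w ≤ x) →
        PosetCompatible (g l) (g l') → l = l') := by
    intro w
    by_cases hw : w ∈ D ∧ ℵ₀ < localSouslin w
    · let E : Set P := {d | d ∈ D ∧ w ≤ d}
      -- There are at most `max ℵ₀ #E` lists over `E`, so uncountability of the local Souslin number
      -- leaves room for an incompatible code for each.
      obtain ⟨A, hA, hAi, hAc⟩ := exists_incompatible_of_lt_localSouslin (max_lt hw.2 (hD w))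
      have hE : #{l : List P | ∀ x ∈ l, x ∈ E} ≤ #A := by
        rw [hAc, ← range_list_map_coe]
        exact mk_range_le.trans (mk_list_le_max E)
      obtain ⟨φ⟩ := hE
      classical
      refine ⟨fun l => if h : ∀ x ∈ l, x ∈ E then (φ ⟨l, h⟩).1 else w, fun l => ?_,
        fun _ => Or.inr fun l l' hl hl' h => ?_⟩
      · dsimp only
        split_ifs with h
        · exact hA (φ ⟨l, h⟩).2
        · exact le_rfl
      · dsimp only at h
        rw [dif_pos (show ∀ x ∈ l, x ∈ E from hl), dif_pos (show ∀ x ∈ l', x ∈ E from hl')] at h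
        by_contra hne
        refine hAi (φ ⟨l, hl⟩).2 (φ ⟨l', hl'⟩).2 (fun h' => hne ?_) h
        exact congrArg Subtype.val (φ.injective (Subtype.ext h'))
    · refine ⟨fun _ => w, fun _ => le_rfl, fun hwD => Or.inl ?_⟩
      exact (hD' w hwD).resolve_right fun h => hw ⟨hwD, h⟩
  choose c hc using key
  exact ⟨c, fun w => (hc w).1, fun w hw => (hc w).2 hw⟩

/-! ### Plays of the Banach-Mazur game -/

section Game

variable {X : Type u} [TopologicalSpace X]

theorem BMPlay.position_congr {P Q : BMPlay X} {n : ℕ} (hU : ∀ k ≤ n, P.U k = Q.U k)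
    (hV : ∀ k < n, P.V k = Q.V k) : P.position n = Q.position n := by
  have h1 : (fun i : Fin (n + 1) => P.U i) = fun i : Fin (n + 1) => Q.U i :=
    funext fun i => hU i (Nat.lt_succ_iff.1 i.2)
  have h2 : (fun i : Fin n => P.V i) = fun i : Fin n => Q.V i := funext fun i => hV i i.2
  simp only [BMPlay.position, h1, h2]

theorem BMPlay.U_le_V (P : BMPlay X) {i j : ℕ} (h : i < j) : P.U j ≤ P.V i := by
  induction j, Nat.succ_le_of_lt h using Nat.le_induction with
  | base => exact P.U_le i
  | succ j hj ih => exact (P.U_le j).trans ((P.V_le j).trans (ih hj))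

theorem BMPlay.nonemptyWins_of_nonempty (P : BMPlay X)
    (h : (⋂ n, (P.V n : Set X)).Nonempty) : P.NonemptyWins := by
  refine ⟨Subset.antisymm ?_ (iInter_mono fun n => P.V_le n), h⟩
  exact subset_iInter fun n => (iInter_subset _ (n + 1)).trans (P.U_le n)

theorem exists_bmPlay {u v : ℕ → NonemptyOpen X} {n : ℕ} (hv : ∀ k < n, v k ≤ u k)
    (hu : ∀ k < n, u (k + 1) ≤ v k) :
    ∃ P : BMPlay X, (∀ k ≤ n, P.U k = u k) ∧ ∀ k < n, P.V k = v k := by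
  refine ⟨⟨fun k => u (min k n), fun k => if k < n then v k else u n, fun k => ?_, fun k => ?_⟩,
    fun k hk => ?_, fun k hk => if_pos hk⟩
  · rcases lt_or_ge k n with h | h
    · simpa [h, h.le] using hv k h
    · simp [h, h.not_gt]
  · rcases lt_or_ge k n with h | h
    · simpa [h, Nat.succ_le_of_lt h] using hu k h
    · simp [h.not_gt, h.trans (Nat.le_succ k)]
  · simp [hk]

theorem BMStrategy.move_position_le (σ : BMStrategy X) (P : BMPlay X) (n : ℕ) :
    σ.move (P.position n) ≤ P.U n :=
  σ.move_le (P.position n)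

theorem BMPosition.rtake_ofFn_zero (p : BMPosition X) (h : p.n = 0) :
    (List.ofFn p.U).rtake 2 = [p.U (Fin.last p.n)] := by
  obtain ⟨n, U, V, h1, h2⟩ := p
  obtain rfl : n = 0 := h
  simp [List.rtake]

theorem BMPosition.rtake_ofFn_succ (p : BMPosition X) (h : p.n ≠ 0) :
    (List.ofFn p.U).rtake 2 = [p.U ⟨p.n - 1, by omega⟩, p.U (Fin.last p.n)] := by
  obtain ⟨n, U, V, h1, h2⟩ := p
  obtain ⟨m, rfl⟩ : ∃ m, n = m + 1 := Nat.exists_eq_succ_of_ne_zero h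
  simp only [List.ofFn_succ', List.concat_eq_append, List.rtake_concat_succ, List.rtake_zero]
  rfl

/-- Answers to the last two moves of EMPTY yield a `2`-tactic. -/
theorem exists_usesLastMoves_two (T₁ : NonemptyOpen X → NonemptyOpen X)
    (T₂ : NonemptyOpen X → NonemptyOpen X → NonemptyOpen X)
    (h1 : ∀ b, T₁ b ≤ b) (h2 : ∀ a b, T₂ a b ≤ b) :
    ∃ σ : BMStrategy X, (∀ P : BMPlay X, σ.move (P.position 0) = T₁ (P.U 0)) ∧
      (∀ (P : BMPlay X) (n : ℕ), σ.move (P.position (n + 1)) = T₂ (P.U n) (P.U (n + 1))) ∧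
      σ.UsesLastMoves 2 := by
  let τ : BMStrategy X :=
    { move := fun p => if h : p.n = 0 then T₁ (p.U (Fin.last p.n)) else
        T₂ (p.U ⟨p.n - 1, by omega⟩) (p.U (Fin.last p.n))
      move_le := fun p => by
        split_ifs with h
        exacts [h1 _, h2 _ _] }
  -- The last two moves form a list of length one or two; the value on other lists is never used.
  let S : List (NonemptyOpen X) → Set X := fun L =>
    match L with
    | [b] => T₁ b
    | [a, b] => T₂ a b
    | _ => ∅
  refine ⟨τ, fun P => rfl, fun P n => rfl, ?_⟩
  classical
  refine ⟨fun L => if h : ∃ L' : List (NonemptyOpen X), L'.map Subtype.val = L then S h.choose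
    else ∅, fun p => ?_⟩
  have e : (List.ofFn fun i => (p.U i : Set X)).rtake 2 =
      ((List.ofFn p.U).rtake 2).map Subtype.val := by
    simp only [List.rtake, List.map_drop, List.map_ofFn, List.length_ofFn]
    rfl
  have hex : ∃ L' : List (NonemptyOpen X),
      L'.map Subtype.val = (List.ofFn fun i => (p.U i : Set X)).rtake 2 := ⟨_, e.symm⟩
  dsimp only
  rw [dif_pos hex, (List.map_injective_iff.2 Subtype.val_injective) (hex.choose_spec.trans e)]
  by_cases h : p.n = 0
  · rw [p.rtake_ofFn_zero h]
    simp only [τ, dif_pos h, S]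
  · rw [p.rtake_ofFn_succ h]
    simp only [τ, dif_neg h, S]

/-- In the first rounds of `P` up to round `n`, the moves of EMPTY are the codes for the initial
segments of the decreasing sequence `w`, and NONEMPTY follows `σ`. -/
structure BMPlay.IsCoded (σ : BMStrategy X) (D : Set (NonemptyRegularOpen X))
    (c : NonemptyRegularOpen X → List (NonemptyRegularOpen X) → NonemptyRegularOpen X)
    (P : BMPlay X) (w : ℕ → NonemptyRegularOpen X) (n : ℕ) : Prop where
  U_eq : ∀ k ≤ n, P.U k = (c (w k) ((List.range k).map w)).1
  V_eq : ∀ k < n, P.V k = σ.move (P.position k)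
  mem : ∀ k ≤ n, w k ∈ D
  anti : ∀ i j, i ≤ j → j ≤ n → w j ≤ w i

/-- The last two sets `w` determine the answer of `σ`, whatever the history and the round numbers:
`B` lies below both codes under `w n`, so the coded lists agree. -/
theorem BMPlay.IsCoded.move_eq {σ : BMStrategy X} {D : Set (NonemptyRegularOpen X)}
    {c : NonemptyRegularOpen X → List (NonemptyRegularOpen X) → NonemptyRegularOpen X}
    (hX : IsQuasiRegular X) (hc : ∀ w l, c w l ≤ w)
    (hcD : ∀ w ∈ D, IsMin w ∨ ∀ l l' : List (NonemptyRegularOpen X),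
      (∀ x ∈ l, x ∈ D ∧ w ≤ x) → (∀ x ∈ l', x ∈ D ∧ w ≤ x) →
        PosetCompatible (c w l) (c w l') → l = l')
    {P P' : BMPlay X} {w w' : ℕ → NonemptyRegularOpen X} {n n' : ℕ}
    (h : P.IsCoded σ D c w (n + 1)) (h' : P'.IsCoded σ D c w' (n' + 1)) (hw : w n = w' n')
    (hw1 : w (n + 1) = w' (n' + 1)) {B : NonemptyOpen X} (hB : (w (n + 1)).1 ≤ B)
    (hBP : B ≤ P.V n) (hBP' : B ≤ P'.V n') :
    σ.move (P.position (n + 1)) = σ.move (P'.position (n' + 1)) := by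
  have h1 : B ≤ (c (w n) ((List.range n).map w)).1 :=
    (hBP.trans (P.V_le n)).trans_eq (h.U_eq n (Nat.le_succ n))
  have h1' : B ≤ (c (w n) ((List.range n').map w')).1 := by
    rw [hw]
    exact (hBP'.trans (P'.V_le n')).trans_eq (h'.U_eq n' (Nat.le_succ n'))
  rcases hcD (w n) (h.mem n (Nat.le_succ n)) with hmin | hcode
  · have key : ∀ V : NonemptyOpen X, V ≤ (w (n + 1)).1 → V = (w n).1 := by
      intro V hV
      have hle : V ≤ (w n).1 := hV.trans (hB.trans (h1.trans (hc _ _)))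
      obtain ⟨r, hr⟩ := hX.exists_le V
      have : w n ≤ r := hmin (hr.trans hle)
      exact hle.antisymm (le_trans (show (w n).1 ≤ r.1 from this) hr)
    rw [key _ ((σ.move_position_le P _).trans ((h.U_eq _ le_rfl).trans_le (hc _ _))),
      key _ ((σ.move_position_le P' _).trans ((h'.U_eq _ le_rfl).trans_le
        ((hc _ _).trans hw1.ge)))]
  · have hl : (List.range n).map w = (List.range n').map w' := by
      refine hcode _ _ ?_ ?_ ⟨w (n + 1), hB.trans h1, hB.trans h1'⟩
      · intro x hx
        obtain ⟨k, hk, rfl⟩ := List.mem_map.1 hx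
        have := List.mem_range.1 hk
        exact ⟨h.mem k (by omega), h.anti k n (by omega) (by omega)⟩
      · intro x hx
        obtain ⟨k, hk, rfl⟩ := List.mem_map.1 hx
        have := List.mem_range.1 hk
        rw [hw]
        exact ⟨h'.mem k (by omega), h'.anti k n' (by omega) (by omega)⟩
    -- The length of the decoded list recovers the round number.
    obtain rfl : n = n' := by simpa using congrArg List.length hl
    have hwk : ∀ k ≤ n + 1, w k = w' k := by
      intro k hk
      rcases Nat.lt_or_ge k n with hkn | hkn
      · exact List.map_inj_left.1 hl k (List.mem_range.2 hkn)
      · obtain rfl | rfl : k = n ∨ k = n + 1 := by omega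
        exacts [hw, hw1]
    have hU : ∀ k ≤ n + 1, P.U k = P'.U k := by
      intro k hk
      rw [h.U_eq k hk, h'.U_eq k hk, hwk k hk]
      congr 2
      refine List.map_inj_left.2 fun i hi => hwk i ?_
      have := List.mem_range.1 hi
      omega
    have hV : ∀ k < n + 1, P.V k = P'.V k := by
      intro k
      induction k using Nat.strong_induction_on with | _ k ih =>
      intro hk
      rw [h.V_eq k hk, h'.V_eq k hk]
      congr 1
      exact BMPlay.position_congr (fun i hi => hU i (by omega)) fun i hi => ih i hi (by omega)
    rw [BMPlay.position_congr hU hV]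

/-- Galvin's coding argument. -/
theorem exists_winning_two_tactic (hX : IsQuasiRegular X) {D : Set (NonemptyRegularOpen X)}
    (hD : IsDenseSubset D) (hDc : ∀ q, #{d | d ∈ D ∧ q ≤ d} < localSouslin q)
    (hDi : ∀ q ∈ D, IsMin q ∨ ℵ₀ < localSouslin q) {σ : BMStrategy X} (hσ : σ.IsWinning) :
    ∃ τ : BMStrategy X, τ.IsWinning ∧ τ.UsesLastMoves 2 := by
  obtain ⟨c, hc, hcD⟩ := exists_list_code hDc hDi
  have hW : ∀ U : NonemptyOpen X, ∃ W ∈ D, W.1 ≤ U := fun U => by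
    obtain ⟨V, hV⟩ := hX.exists_le U
    obtain ⟨W, hWD, hWV⟩ := hD V
    exact ⟨W, hWD, le_trans (show W.1 ≤ V.1 from hWV) hV⟩
  choose W hWD hWU using hW
  -- `E₁` and `E₂` describe the simulated histories consistent with EMPTY's first or last two moves.
  -- The tactic chooses any one of them; `move_eq` makes the choice immaterial in later rounds.
  let E₁ : NonemptyOpen X → BMPlay X → Prop := fun b P => P.U 0 = (c (W b) []).1
  let E₂ : NonemptyOpen X → NonemptyOpen X →
      BMPlay X × (ℕ → NonemptyRegularOpen X) × ℕ → Prop := fun a b q =>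
    q.1.IsCoded σ D c q.2.1 (q.2.2 + 1) ∧ q.2.1 q.2.2 = W a ∧ q.2.1 (q.2.2 + 1) = W b ∧
      b ≤ q.1.V q.2.2
  classical
  have hcW : ∀ b l, (c (W b) l).1 ≤ b := fun b l =>
    le_trans (show (c (W b) l).1 ≤ (W b).1 from hc _ _) (hWU b)
  obtain ⟨τ, hτ1, hτ2, hτ⟩ := exists_usesLastMoves_two (X := X)
    (fun b => if h : ∃ P, E₁ b P then σ.move (h.choose.position 0) else b)
    (fun a b => if h : ∃ q, E₂ a b q then σ.move (h.choose.1.position (h.choose.2.2 + 1)) else b)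
    (fun b => by
      split_ifs with h
      · exact (σ.move_position_le _ _).trans (h.choose_spec.trans_le (hcW b _))
      · exact le_rfl)
    (fun a b => by
      split_ifs with h
      · obtain ⟨h1, -, h3, -⟩ := h.choose_spec
        refine (σ.move_position_le _ _).trans ((h1.U_eq _ le_rfl).trans_le ?_)
        rw [h3]
        exact hcW b _
      · exact le_rfl)
  refine ⟨τ, fun Q hQ => ?_, hτ⟩
  let w : ℕ → NonemptyRegularOpen X := fun k => W (Q.U k)
  -- The moves attributed to EMPTY in the simulated play, which has the same answers of NONEMPTY as
  -- `Q`.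
  let u : ℕ → NonemptyOpen X := fun k => (c (w k) ((List.range k).map w)).1
  have huw : ∀ k, u k ≤ (w k).1 := fun k => hc _ _
  have huQ : ∀ k, u k ≤ Q.U k := fun k => hcW _ _
  have main : ∀ n, Q.V n ≤ u n ∧ ∀ P : BMPlay X, (∀ k ≤ n, P.U k = u k) →
      (∀ k < n, P.V k = Q.V k) → Q.V n = σ.move (P.position n) := by
    intro n
    induction n using Nat.strong_induction_on with | _ n ih =>
    obtain ⟨P, hPU, hPV⟩ := exists_bmPlay (u := u) (v := Q.V) (n := n) (fun k hk => (ih k hk).1)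
      fun k _ => (huQ (k + 1)).trans (Q.U_le k)
    have hP : P.IsCoded σ D c w n := by
      refine ⟨hPU, fun k hk => ?_, fun k _ => hWD _, fun i j hij hj => ?_⟩
      · rw [hPV k hk]
        exact (ih k hk).2 P (fun i hi => hPU i (by omega)) fun i hi => hPV i (by omega)
      · rcases hij.lt_or_eq with h | rfl
        · exact (hWU (Q.U j)).trans ((Q.U_le_V h).trans ((ih i (by omega)).1.trans (huw i)))
        · exact le_rfl
    have hmove : Q.V n = σ.move (P.position n) := by
      rcases n with _ | n
      · have hex : ∃ P, E₁ (Q.U 0) P := ⟨P, hPU 0 le_rfl⟩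
        rw [hQ, hτ1, dif_pos hex]
        congr 1
        refine BMPlay.position_congr (fun k hk => ?_) fun k hk => absurd hk (Nat.not_lt_zero k)
        obtain rfl : k = 0 := Nat.le_zero.1 hk
        exact hex.choose_spec.trans (hPU 0 le_rfl).symm
      · have hle : Q.U (n + 1) ≤ P.V n := (Q.U_le n).trans_eq (hPV n (Nat.lt_succ_self n)).symm
        have hex : ∃ q, E₂ (Q.U n) (Q.U (n + 1)) q := ⟨(P, w, n), hP, rfl, rfl, hle⟩
        rw [hQ, hτ2, dif_pos hex]
        obtain ⟨h1, h2, h3, h4⟩ := hex.choose_spec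
        refine h1.move_eq hX hc hcD hP h2 h3 (B := Q.U (n + 1)) ?_ h4 hle
        rw [h3]
        exact hWU _
    refine ⟨?_, fun P' hU hV => ?_⟩
    · rw [hmove]
      exact (σ.move_position_le P n).trans_eq (hPU n le_rfl)
    · rw [hmove]
      congr 1
      exact BMPlay.position_congr (fun k hk => (hPU k hk).trans (hU k hk).symm)
        fun k hk => (hPV k hk).trans (hV k hk).symm
  let P : BMPlay X := ⟨u, Q.V, fun n => (main n).1, fun n => (huQ (n + 1)).trans (Q.U_le n)⟩
  have hP : P.Follows σ := fun n => (main n).2 P (fun _ _ => rfl) fun _ _ => rfl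
  exact Q.nonemptyWins_of_nonempty (hσ P hP).2

end Game

theorem exists_winning_two_tactic_of_vws (hG : GCH.{u}) (hV : VWS.{u}) (X : Type u)
    [TopologicalSpace X] (hX : IsQuasiRegular X) (h : ∃ σ : BMStrategy X, σ.IsWinning) :
    ∃ σ : BMStrategy X, σ.IsWinning ∧ σ.UsesLastMoves 2 := by
  obtain ⟨σ, hσ⟩ := h
  obtain ⟨D, hD, hDc, hDi⟩ :=
    exists_dense_lt_localSouslin hG hV (isSeparative_nonemptyRegularOpen (X := X))
  exact exists_winning_two_tactic hX hD hDc hDi hσ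

/-! ### Very weak square from square -/

theorem exists_between_of_aleph0_le_cof_Iio {I : Type u} [LinearOrder I] {a : I}
    (h : ℵ₀ ≤ Order.cof (Iio a)) {x : I} (hx : x < a) : ∃ y, x < y ∧ y < a := by
  obtain ⟨y, hy⟩ := exists_gt_of_aleph0_le_cof h ⟨x, hx⟩
  exact ⟨y.1, hy, y.2⟩

/-- Very weak square follows from the existence of few sets that contain the small bounded subsets
of some cofinal subsets. -/
theorem veryWeakSquareAt_of_families {lam eta kap : Cardinal.{u}} (hk : kap.IsRegular)
    (hkl : kap ≤ lam) (hke : kap ≤ eta) (F : SuccOrd lam → Set (Set (SuccOrd lam)))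
    (hF : ∀ b, #(F b) ≤ lam) (c : SuccOrd lam → Set (SuccOrd lam))
    (hc : ∀ a, eta ≤ Order.cof (Iio a) → c a ⊆ Iio a)
    (hcE : ∀ a, eta ≤ Order.cof (Iio a) → ∀ E : Set (SuccOrd lam),
      (∀ x < a, ∃ e ∈ E, x < e ∧ e < a) →
        ∀ x < a, ∃ y ∈ c a, x < y ∧ (IsLimitPointBelow E y ∨ y ∈ Order.succ '' E))
    (hcF : ∀ a, eta ≤ Order.cof (Iio a) → ∀ b < a, ∀ Y ⊆ c a ∩ Iio b, #Y < kap →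
      ∃ g < a, Y ∈ F g) :
    VeryWeakSquareAt lam eta kap := by
  have hl : ℵ₀ ≤ lam := hk.aleph0_le.trans hkl
  have hls : ℵ₀ ≤ Order.succ lam := hl.trans (Order.le_succ lam)
  let I := SuccOrd lam
  have hI : #I = Order.succ lam := by rw [mk_toType, card_ord]
  have hcofI : Order.cof I = Order.succ lam := cof_succOrd hl
  have hImax : NoMaxOrder I := Cardinal.noMaxOrder hls
  have hφ : Nonempty ((Σ g, F g) ↪ I) := by
    rw [← Cardinal.le_def, hI, mk_sigma]
    refine (sum_le_mk_mul_iSup _).trans (mul_le_of_le hls hI.le (ciSup_le' fun g => ?_))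
    exact (hF g).trans (Order.le_succ lam)
  obtain ⟨φ⟩ := hφ
  have hh : ∀ g : I, ∃ w, ∀ Y : F g, Order.succ (φ ⟨g, Y⟩) < w := by
    intro g
    have : #(range fun Y : F g => Order.succ (φ ⟨g, Y⟩)) < Order.cof I := by
      rw [hcofI, Order.lt_succ_iff]
      exact mk_range_le.trans (hF g)
    obtain ⟨w, hw⟩ := exists_forall_lt_of_mk_lt_cof this
    exact ⟨w, fun Y => hw _ (mem_range_self Y)⟩
  choose h hh using hh
  let E : Set I := {x | ∀ y < x, h y < x}
  -- Every point of `D` of cofinality at least `eta` must be a limit of `E`, so `E` itself is not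
  -- included. Its successors are harmless, and they keep `D` cofinal below limits of `E` of
  -- countable cofinality.
  let D : Set I := {y | IsLimitPointBelow E y} ∪ Order.succ '' E
  have hEcof : ∀ x, ∃ e ∈ E, x < e := by
    intro x
    obtain ⟨e, hxe, he, -⟩ := exists_closed_le_cof (I := I) hk
      (by rw [hcofI]; exact Order.lt_succ_iff.2 hkl)
      (fun z => by rw [hcofI]; exact mk_Iic_lt_of_ord_toType hls z) h x
    exact ⟨e, he, hxe⟩
  have hD : IsClub D := by
    refine ⟨fun d hdD hdne _ y hy => ?_, fun x => ?_⟩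
    · by_cases hyd : y ∈ d
      · exact hdD hyd
      have hlt : ∀ z < y, ∃ t ∈ d, z < t ∧ t < y := by
        intro z hz
        obtain ⟨t, ht, hzt⟩ := (lt_isLUB_iff hy).1 hz
        exact ⟨t, ht, hzt, (hy.1 ht).lt_of_ne fun h => hyd (h ▸ ht)⟩
      have hlim : ∀ z < y, ∃ e ∈ E, z < e ∧ e < y := by
        intro z hz
        obtain ⟨t, -, hzt, hty⟩ := hlt z hz
        obtain ⟨t', ht', htt', hty'⟩ := hlt t hty
        rcases hdD ht' with hl | ⟨e, he, rfl⟩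
        · obtain ⟨e, he, hze, het⟩ := hl.2 z (hzt.trans htt')
          exact ⟨e, he, hze, het.trans hty'⟩
        · exact ⟨e, he, hzt.trans_le (Order.le_of_lt_succ htt'), (Order.lt_succ e).trans hty'⟩
      obtain ⟨t, ht⟩ := hdne
      obtain ⟨e, he, -, hey⟩ := hlim t ((hy.1 ht).lt_of_ne fun h => hyd (h ▸ ht))
      exact Or.inl ⟨⟨e, he, hey⟩, hlim⟩
    · obtain ⟨e, he, hxe⟩ := hEcof x
      exact ⟨Order.succ e, Or.inr ⟨e, he, rfl⟩, (hxe.trans (Order.lt_succ e)).le⟩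
  have hnsucc : ∀ a : I, eta ≤ Order.cof (Iio a) → ∀ x, Order.succ x ≠ a := by
    rintro _ ha x rfl
    obtain ⟨y, hxy, hy⟩ := exists_between_of_aleph0_le_cof_Iio
      (hk.aleph0_le.trans (hke.trans ha)) (Order.lt_succ x)
    exact hxy.not_ge (Order.le_of_lt_succ hy)
  have hDlim : ∀ a ∈ D, eta ≤ Order.cof (Iio a) → IsLimitPointBelow E a := by
    rintro a (h | ⟨e, -, rfl⟩) ha
    · exact h
    · exact absurd rfl (hnsucc _ ha e)
  have hK : ∀ a : I, ∃ K : Set I, a ∈ D → eta ≤ Order.cof (Iio a) →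
      K ⊆ c a ∩ D ∧ (∀ b < a, ∃ k ∈ K, b ≤ k) ∧
        Ordinal.type (α := K) (· < ·) = (Order.cof (Iio a)).ord := by
    intro a
    by_cases ha : a ∈ D ∧ eta ≤ Order.cof (Iio a)
    · have hs : IsCofinal {x : Iio a | x.1 ∈ c a ∩ D} := by
        intro x
        obtain ⟨y, hy, hxy, hyD⟩ := hcE a ha.2 E (hDlim a ha.1 ha.2).2 x.1 x.2
        exact ⟨⟨y, hc a ha.2 hy⟩, ⟨hy, hyD⟩, hxy.le⟩
      obtain ⟨t, hts, ht, htype⟩ := Ordinal.exists_ord_cof_eq_of_isCofinal hs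
      refine ⟨Subtype.val '' t, fun _ _ => ⟨?_, fun b hb => ?_, ?_⟩⟩
      · rintro _ ⟨x, hx, rfl⟩
        exact hts hx
      · obtain ⟨k, hk, hbk⟩ := ht ⟨b, hb⟩
        exact ⟨k.1, mem_image_of_mem _ hk, hbk⟩
      · rw [← htype]
        exact (((Subtype.strictMono_coe _).strictMonoOn t).orderIso).ordinalType_congr.symm
    · exact ⟨∅, fun h1 h2 => absurd ⟨h1, h2⟩ ha⟩
  choose K hK using hK
  classical
  -- Successor indices are free, since they do not have cofinality at least `eta`; they are used to
  -- list all members of the families, and points of `E` bound the indices.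
  let C : I → Set I := fun x =>
    if h : ∃ p : Σ g, F g, Order.succ (φ p) = x then h.choose.2.1 else K x
  have hCsucc : ∀ p : Σ g, F g, C (Order.succ (φ p)) = p.2.1 := by
    intro p
    have hex : ∃ q : Σ g, F g, Order.succ (φ q) = Order.succ (φ p) := ⟨p, rfl⟩
    simp only [C, dif_pos hex]
    rw [φ.injective (Order.succ_injective hex.choose_spec)]
  have hCK : ∀ a : I, eta ≤ Order.cof (Iio a) → C a = K a := fun a ha =>
    dif_neg fun ⟨p, hp⟩ => hnsucc a ha _ hp
  refine ⟨C, D, hD, fun a haD ha => ?_⟩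
  have hCa := hK a haD ha
  rw [← hCK a ha] at hCa
  obtain ⟨h1, h2, h3⟩ := hCa
  refine ⟨⟨fun x hx => ⟨hc a ha (h1 hx).1, (h1 hx).2⟩, fun b hb => h2 b hb.1, h3⟩, ?_⟩
  intro Y hY hYc
  obtain ⟨b, hb, hYb⟩ := exists_lt_forall_lt_of_mk_lt_cof_Iio
    (fun y hy => hc a ha (h1 (hY hy)).1) (hYc.trans_le (hke.trans ha))
  obtain ⟨g, hg, hYg⟩ := hcF a ha b hb Y (fun y hy => ⟨(h1 (hY hy)).1, hYb y hy⟩) hYc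
  obtain ⟨e, he, hge, hea⟩ := (hDlim a haD ha).2 g hg
  refine ⟨Order.succ (φ ⟨g, ⟨Y, hYg⟩⟩), ((hh g ⟨Y, hYg⟩).trans (he g hge)).trans hea, ?_⟩
  rw [hCsucc]
  exact ⟨Subset.rfl, hY, hYc⟩

/-- Here `λ ^ c ≤ λ` for `c < κ`, so all small subsets of `Iio b` form an admissible family and no
square is needed. -/
theorem veryWeakSquareAt_of_le_cof (hG : GCH.{u}) {lam eta kap : Cardinal.{u}}
    (hk : kap.IsRegular) (hkl : kap ≤ lam) (hke : kap ≤ eta) (hcof : kap ≤ lam.ord.cof) :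
    VeryWeakSquareAt lam eta kap := by
  have hl : ℵ₀ ≤ lam := hk.aleph0_le.trans hkl
  refine veryWeakSquareAt_of_families hk hkl hke (fun b => {Y | Y ⊆ Iio b ∧ #Y < kap}) (fun b => ?_)
    (fun a => Iio a) (fun a _ => Subset.rfl) (fun a ha E hE x hx => ?_)
    fun a _ b hb Y hY hYc => ⟨b, hb, fun y hy => (hY hy).2, hYc⟩
  · exact mk_small_subsets_le hk.aleph0_le hkl
      (fun c hc => hG.power_le_of_lt_cof hl (hc.trans_le hcof)) (mk_Iio_succOrd_le b)
  · have ha' := hk.aleph0_le.trans (hke.trans ha)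
    obtain ⟨e, he, hxe, hea⟩ := hE x hx
    obtain ⟨y, hey, hya⟩ := exists_between_of_aleph0_le_cof_Iio ha' hea
    exact ⟨Order.succ e, (Order.succ_le_of_lt hey).trans_lt hya, hxe.trans_le (Order.le_succ e),
      Or.inr ⟨e, he, rfl⟩⟩

/-- Below a point of uncountable cofinality, a club has points that are limits both of the club and
of a given unbounded set. -/
theorem exists_isLimitPointBelow {I : Type u} [LinearOrder I] [WellFoundedLT I] {a : I}
    (ha : ℵ₀ < Order.cof (Iio a)) {K E : Set I}
    (hK : IsClub {x : Iio a | x.1 ∈ K}) (hE : ∀ x < a, ∃ e ∈ E, x < e ∧ e < a) {x : I}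
    (hx : x < a) :
    ∃ y ∈ K, x < y ∧ IsLimitPointBelow E y ∧ IsLimitPointBelow K y := by
  have hstep : ∀ z : Iio a, ∃ k : Iio a, k.1 ∈ K ∧ ∃ e ∈ E, z.1 < e ∧ e < k.1 := by
    intro z
    obtain ⟨e, he, hze, hea⟩ := hE z.1 z.2
    obtain ⟨e', hee', hea'⟩ := exists_between_of_aleph0_le_cof_Iio ha.le hea
    obtain ⟨k, hk, hek⟩ := hK.isCofinal ⟨e', hea'⟩
    exact ⟨k, hk, e, he, hze, hee'.trans_le hek⟩
  choose s hsK e heE hze hes using hstep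
  -- Members of `K` interleaved with members of `E`; the supremum is below `a` by uncountable
  -- cofinality, and is a limit of both sets.
  let k : ℕ → Iio a := fun n => Nat.rec (s ⟨x, hx⟩) (fun _ z => s z) n
  have hkK : ∀ n, (k n).1 ∈ K := fun n => by cases n <;> exact hsK _
  have hkx : x < (k 0).1 := (hze ⟨x, hx⟩).trans (hes _)
  have hkmono : StrictMono k := strictMono_nat_of_lt_succ fun n => (hze (k n)).trans (hes (k n))
  have hb : #(range k) < Order.cof (Iio a) :=
    (mk_le_aleph0_iff.2 (countable_range k).to_subtype).trans_lt ha
  obtain ⟨b, hb⟩ := exists_forall_lt_of_mk_lt_cof hb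
  have wf : WellFounded ((· < ·) : Iio a → Iio a → Prop) := wellFounded_lt
  have hne : (upperBounds (range k)).Nonempty := ⟨b, fun y hy => (hb y hy).le⟩
  set y := wf.min _ hne
  have hy : IsLUB (range k) y := ⟨wf.min_mem _ hne, fun z hz =>
    not_lt.1 (wf.not_lt_min (upperBounds (range k)) hz)⟩
  have hky : ∀ n, k n < y := fun n =>
    (hkmono (Nat.lt_succ_self n)).trans_le (hy.1 (mem_range_self (n + 1)))
  have hlt : ∀ z < y.1, ∃ n, z < (k n).1 := by
    intro z hz
    obtain ⟨_, ⟨n, rfl⟩, hn⟩ := (lt_isLUB_iff hy).1 (show (⟨z, hz.trans y.2⟩ : Iio a) < y from hz)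
    exact ⟨n, hn⟩
  refine ⟨y.1, hK.isLUB_mem (range_subset_iff.2 hkK) (range_nonempty k) hy, hkx.trans (hky 0),
    ⟨⟨e (k 0), heE _, (hes (k 0)).trans (hky 1)⟩, fun z hz => ?_⟩,
    ⟨⟨(k 0).1, hkK 0, show (k 0).1 < y.1 from hky 0⟩, fun z hz => ?_⟩⟩
  · obtain ⟨n, hn⟩ := hlt z hz
    exact ⟨e (k n), heE _, hn.trans (hze (k n)), (hes (k n)).trans (hky (n + 1))⟩
  · obtain ⟨n, hn⟩ := hlt z hz
    exact ⟨(k n).1, hkK n, hn, show (k n).1 < y.1 from hky n⟩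

/-- The family at `b` is the power set of `C b` when `#(C b) < λ`, of size at most `λ` by `GCH`. A
bounded subset of `C a` lies below a limit point `y` of `C a`, where `C y = C a ∩ y` is a proper
initial segment of a set of type at most `λ`. -/
theorem SquareAt.veryWeakSquareAt (hG : GCH.{u}) {lam eta kap : Cardinal.{u}}
    (hS : SquareAt lam) (hk : kap.IsRegular) (hk0 : ℵ₀ < kap) (hkl : kap ≤ lam) (hke : kap ≤ eta) :
    VeryWeakSquareAt lam eta kap := by
  have hl0 : ℵ₀ < lam := hk0.trans_le hkl
  obtain ⟨C, hC⟩ := hS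
  have hlim : ∀ a : SuccOrd lam, eta ≤ Order.cof (Iio a) → Order.IsSuccLimit a := by
    intro a ha
    have ha0 : ℵ₀ ≤ Order.cof (Iio a) := hk.aleph0_le.trans (hke.trans ha)
    refine ⟨fun hmin => ?_, fun b hb => ?_⟩
    · have : Nonempty (Iio a) := by
        rw [← Order.cof_ne_zero_iff]
        exact (aleph0_pos.trans_le ha0).ne'
      obtain ⟨y, hy⟩ := this
      exact (show y < a from hy).not_ge (hmin (le_of_lt hy))
    · obtain ⟨y, hby, hya⟩ := exists_between_of_aleph0_le_cof_Iio ha0 hb.1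
      exact hb.2 hby hya
  refine veryWeakSquareAt_of_families hk hkl hke (fun b => {Y | Y ⊆ C b ∧ #(C b) < lam})
    (fun b => ?_) C (fun a ha => (hC a (hlim a ha)).1) (fun a ha E hE x hx => ?_)
    fun a ha b hb Y hY hYc => ?_
  · by_cases hb : #(C b) < lam
    · refine (mk_le_mk_of_subset (fun Y hY => hY.1 : _ ⊆ 𝒫 (C b))).trans ?_
      rw [mk_powerset]
      exact hG.two_power_le hl0 hb
    · have : {Y | Y ⊆ C b ∧ #(C b) < lam} = ∅ := eq_empty_of_forall_notMem fun Y hY => hb hY.2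
      rw [this, mk_eq_zero]
      exact zero_le
  · obtain ⟨-, hclub, -, -⟩ := hC a (hlim a ha)
    obtain ⟨y, hy, hxy, hyE, -⟩ := exists_isLimitPointBelow (hk0.trans_le (hke.trans ha)) hclub
      hE hx
    exact ⟨y, hy, hxy, Or.inl hyE⟩
  · obtain ⟨hCa, hclub, htype, hcoh⟩ := hC a (hlim a ha)
    have ha0 : ℵ₀ < Order.cof (Iio a) := hk0.trans_le (hke.trans ha)
    obtain ⟨y, hy, hby, -, hyC⟩ := exists_isLimitPointBelow (E := univ) ha0 hclub
      (fun x hx => by simpa using exists_between_of_aleph0_le_cof_Iio ha0.le hx) hb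
    have hya : y < a := hCa hy
    have he : C y = C a ∩ Iio y := hcoh y hya hyC
    refine ⟨y, hya, fun z hz => ?_, ?_⟩
    · rw [he]
      exact ⟨(hY hz).1, lt_trans (hY hz).2 hby⟩
    · have h1 : Ordinal.typein (α := C a) (· < ·) ⟨y, hy⟩ < lam.ord :=
        (Ordinal.typein_lt_type _ _).trans_le htype
      have h2 := lt_ord.1 h1
      rw [Ordinal.card_typein] at h2
      refine lt_of_le_of_lt ?_ h2
      rw [he]
      exact mk_le_of_injective
        (f := fun z : (C a ∩ Iio y : Set (SuccOrd lam)) =>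
          (⟨⟨z.1, z.2.1⟩, z.2.2⟩ : {w : C a // w < ⟨y, hy⟩}))
        fun z z' h => Subtype.ext (congrArg (fun w => w.1.1) h)

/-- Square is only needed when `cf λ < κ`, and then `κ` is uncountable because `cf λ` is infinite.
-/
theorem vws_of_square (hG : GCH.{u}) (hS : Square.{u}) : VWS.{u} := by
  intro lam eta kap hke hel _ hk
  have hkl : kap ≤ lam := hke.trans hel
  rcases le_or_gt kap lam.ord.cof with hcof | hcof
  · exact veryWeakSquareAt_of_le_cof hG hk hkl hke hcof
  · have h0 : ℵ₀ ≤ lam.ord.cof := by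
      rw [Ordinal.aleph0_le_cof_iff, Ordinal.one_lt_cof_iff]
      exact isSuccLimit_ord (hk.aleph0_le.trans hkl)
    have hk0 : ℵ₀ < kap := h0.trans_lt hcof
    exact (hS lam (hk0.trans_le hkl)).veryWeakSquareAt hG hk hk0 hkl hke

theorem theorem3 :
    (GCH.{u} ∧ VWS.{u} → Nabla.{u}) ∧
    (GCH.{u} ∧ VWS.{u} →
      ∀ (X : Type u) [TopologicalSpace X], IsQuasiRegular X →
        (∃ σ : BMStrategy X, σ.IsWinning) →
          ∃ σ : BMStrategy X, σ.IsWinning ∧ σ.UsesLastMoves 2) ∧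
    (GCH.{u} ∧ Square.{u} →
      ∀ (X : Type u) [TopologicalSpace X], IsQuasiRegular X →
        (∃ σ : BMStrategy X, σ.IsWinning) →
          ∃ σ : BMStrategy X, σ.IsWinning ∧ σ.UsesLastMoves 2) :=
  ⟨fun h => nabla_of_vws h.1 h.2, fun h => exists_winning_two_tactic_of_vws h.1 h.2,
    fun h => exists_winning_two_tactic_of_vws h.1 (vws_of_square h.1 h.2)⟩
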